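/- **Proposition 3.4 (Ricci equation for a given immersion).** Let $\varepsilon\in\{-1,1\}$, $c\in\{-1,1\}$, $N\ge 2$ and $0\le\lambda\le N$. Let $\mathbb{R}^{N+1}_\nu$ denote $\mathbb{R}^{N+1}$ with the metric $g_0=\sum_{i=0}^{N-\nu}dx_i^2-\sum_{i=N-\nu+1}^{N}dx_i^2$, and let $\mathbb{M}^N_\lambda(c)$ be a connected component of the hyperquadric $\{p : g_0(p,p)=c\}$ in $\mathbb{R}^{N+1}_{\lambda}$ if $c=1$, and in $\mathbb{R}^{N+1}_{\lambda+1}$ if $c=-1$, with the induced metric $g$. Let $I\subset\mathbb{R}$ be an open interval, let $a:I\to(0,\infty)$ be smooth, and let $\bar P=\varepsilon I\times_a\mathbb{M}^N_\lambda(c)$ be the product $I\times\mathbb{M}^N_\lambda(c)$ with the warped metric $\langle\ ,\ \rangle=\varepsilon\,dt^2+a(t)^2 g$, Levi-Civita connection $\bar\nabla$ and curvature tensor $\bar R$. Curvature operators $\mathcal{R}$ of connections $\mathcal{D}$ follow the convention $\mathcal{R}(X,Y)Z=\mathcal{D}_X\mathcal{D}_YZ-\mathcal{D}_Y\mathcal{D}_XZ-\mathcal{D}_{[X,Y]}Z$.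 Let $M^n$ be a semi-Riemannian manifold isometrically immersed in $\bar P$, with normal bundle $TM^\perp$. Write $(\cdot)^\perp$ for the component normal to $M$, let $\alpha(X,Y)=(\bar\nabla_XY)^\perp$ be the second fundamental form, let $A_\eta$ be the shape operator, given by $\langle A_\eta X,Y\rangle=\langle\alpha(X,Y),\eta\rangle$, and let $R^\perp$ be the curvature of the normal connection $\nabla^\perp_X\eta=(\bar\nabla_X\eta)^\perp$. Then, for all $X,Y\in TM$ and $\eta\in TM^\perp$, $$R^\perp(X,Y)\eta=\alpha(A_\eta Y,X)-\alpha(A_\eta X,Y),$$ and the ambient curvature term of the Ricci equation vanishes: $\big(\bar R(X,Y)\eta\big)^\perp=0$. -/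

import Mathlib

open scoped Manifold ContDiff
open Bundle

noncomputable section

/-! ### Semi-Riemannian metrics and the Levi-Civita connection along a map -/

section SemiRiemannian

variable {E : Type*} [NormedAddCommGroup E] [NormedSpace ℝ E]
  {H : Type*} [TopologicalSpace H] (I : ModelWithCorners ℝ E H)
  {M : Type*} [TopologicalSpace M] [ChartedSpace H M] [IsManifold I ∞ M]
  {F : Type*} [NormedAddCommGroup F] [NormedSpace ℝ F]
  {K : Type*} [TopologicalSpace K] (J : ModelWithCorners ℝ F K)
  {P : Type*} [TopologicalSpace P] [ChartedSpace K P] [IsManifold J ∞ P]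

/-- A smooth semi-Riemannian metric `g` on `M`: a symmetric, nondegenerate bilinear form on every
tangent space, depending smoothly on the point. (On a connected manifold the index is then
constant.) -/
structure IsSemiRiemannianMetric
    (g : Π x : M, TangentSpace I x →L[ℝ] TangentSpace I x →L[ℝ] ℝ) : Prop where
  symm : ∀ (x : M) (u v : TangentSpace I x), g x u v = g x v u
  nondegenerate : ∀ (x : M) (u : TangentSpace I x), (∀ v, g x u v = 0) → u = 0
  contMDiff : ContMDiff I (I.prod 𝓘(ℝ, E →L[ℝ] E →L[ℝ] ℝ)) ∞
    (fun x ↦ TotalSpace.mk' (E →L[ℝ] E →L[ℝ] ℝ)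
      (E := fun x : M ↦ TangentSpace I x →L[ℝ] TangentSpace I x →L[ℝ] ℝ) x (g x))

/-- The map `f` is an isometric immersion of `(M, gM)` into `(P, g)`: it is smooth and pulls `g`
back to `gM`. (Its differentials are injective as soon as `gM` is nondegenerate.) -/
structure IsIsometricImmersion
    (gM : Π x : M, TangentSpace I x →L[ℝ] TangentSpace I x →L[ℝ] ℝ)
    (g : Π p : P, TangentSpace J p →L[ℝ] TangentSpace J p →L[ℝ] ℝ) (f : M → P) : Prop where
  contMDiff : ContMDiff I J ∞ f
  isometric : ∀ (x : M) (u v : TangentSpace I x),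
    gM x u v = g (f x) (mfderiv I J f x u) (mfderiv I J f x v)

/-- The matrix `(g_ij)` of the metric `g` in the preferred chart around `p₀`, as a function of the
coordinates `y`, with values in the bilinear forms on the model space. -/
def metricInChart (g : Π p : P, TangentSpace J p →L[ℝ] TangentSpace J p →L[ℝ] ℝ) (p₀ : P) (y : F) :
    F →L[ℝ] F →L[ℝ] ℝ :=
  let S := (trivializationAt F (TangentSpace J : P → Type _) p₀).symmL ℝ ((extChartAt J p₀).symm y)
  (S.precomp ℝ).comp ((g ((extChartAt J p₀).symm y)).comp S)

/-- The Christoffel symbols `Γ(u, v) = Γ^k_ij u^i v^j` of `g` in the preferred chart around `p₀`,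
at the point with coordinates `y`: the vector with
`2 g(Γ(u, v), w) = ∂_u g(v, w) + ∂_v g(u, w) - ∂_w g(u, v)` for all `w`. -/
def christoffel (g : Π p : P, TangentSpace J p →L[ℝ] TangentSpace J p →L[ℝ] ℝ) (p₀ : P)
    (y u v : F) : F :=
  (metricInChart J g p₀ y).inverse
    ((1 / 2 : ℝ) • (fderiv ℝ (metricInChart J g p₀) y u v + fderiv ℝ (metricInChart J g p₀) y v u
      - ((fderiv ℝ (metricInChart J g p₀) y).flip u).flip v))

/-- The Levi-Civita connection of `(P, g)` along a map `f : M → P` (that is, the pullback to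
`f^* TP` of the Levi-Civita connection of `g`): the covariant derivative at `x`, in the direction
`u`, of the vector field `V` along `f`. In the preferred chart around `f x` it is
`(∇_u V)^k = u(V^k) + Γ^k_ij df(u)^i V^j`.
For `f = id` it is the Levi-Civita connection of `g` on `P`. -/
def covDerivAlong (g : Π p : P, TangentSpace J p →L[ℝ] TangentSpace J p →L[ℝ] ℝ) (f : M → P)
    (V : Π x : M, TangentSpace J (f x)) (x : M) (u : TangentSpace I x) : TangentSpace J (f x) :=
  (mvfderiv I (fun x' ↦ (trivializationAt F (TangentSpace J) (f x)
      (⟨f x', V x'⟩ : TangentBundle J P)).2) x u : F)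
    + christoffel J g (f x) (extChartAt J (f x) (f x)) (mfderiv I J f x u) (V x)

/-- The Riemann curvature tensor `R(u, v)w = ∇_X ∇_Y Z - ∇_Y ∇_X Z - ∇_[X,Y] Z` of `(P, g)` at `p`,
where `X`, `Y`, `Z` are the extensions of `u`, `v`, `w` with constant components in the preferred
chart around `p`. -/
def curvatureTensor (g : Π p : P, TangentSpace J p →L[ℝ] TangentSpace J p →L[ℝ] ℝ) (p : P)
    (u v w : TangentSpace J p) : TangentSpace J p :=
  let X : Π q : P, TangentSpace J q := FiberBundle.extend F u
  let Y : Π q : P, TangentSpace J q := FiberBundle.extend F v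
  let Z : Π q : P, TangentSpace J q := FiberBundle.extend F w
  covDerivAlong J J g id (fun q ↦ covDerivAlong J J g id Z q (Y q)) p u
    - covDerivAlong J J g id (fun q ↦ covDerivAlong J J g id Z q (X q)) p v
    - covDerivAlong J J g id Z p (VectorField.mlieBracket J X Y p)

/-! ### Normal bundle, second fundamental form, shape operator, normal curvature -/

/-- The vector `w ∈ T_{f x} P` is normal to `f` at `x`. -/
def IsNormalTo (g : Π p : P, TangentSpace J p →L[ℝ] TangentSpace J p →L[ℝ] ℝ) (f : M → P) (x : M)
    (w : TangentSpace J (f x)) : Prop :=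
  ∀ u : TangentSpace I x, g (f x) w (mfderiv I J f x u) = 0

/-- The tangential component of `w ∈ T_{f x} P`, as the vector `u ∈ T_x M` with
`gM(u, z) = g(w, df z)` for all `z ∈ T_x M`. -/
def tangentPart (gM : Π x : M, TangentSpace I x →L[ℝ] TangentSpace I x →L[ℝ] ℝ)
    (g : Π p : P, TangentSpace J p →L[ℝ] TangentSpace J p →L[ℝ] ℝ) (f : M → P) (x : M)
    (w : TangentSpace J (f x)) : TangentSpace I x :=
  (gM x).inverse ((g (f x) w).comp (mfderiv I J f x))

/-- The normal component `w^⊥` of `w ∈ T_{f x} P`. -/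
def normalPart (gM : Π x : M, TangentSpace I x →L[ℝ] TangentSpace I x →L[ℝ] ℝ)
    (g : Π p : P, TangentSpace J p →L[ℝ] TangentSpace J p →L[ℝ] ℝ) (f : M → P) (x : M)
    (w : TangentSpace J (f x)) : TangentSpace J (f x) :=
  w - mfderiv I J f x (tangentPart I J gM g f x w)

/-- The second fundamental form `α(u, v) = (∇_u df(V))^⊥` at `x`, where `V` is the extension of `v`
to a vector field on `M` with constant components in the preferred chart around `x`. -/
def secondFundamentalForm (gM : Π x : M, TangentSpace I x →L[ℝ] TangentSpace I x →L[ℝ] ℝ)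
    (g : Π p : P, TangentSpace J p →L[ℝ] TangentSpace J p →L[ℝ] ℝ) (f : M → P) (x : M)
    (u v : TangentSpace I x) : TangentSpace J (f x) :=
  let V : Π x' : M, TangentSpace I x' := FiberBundle.extend E v
  normalPart I J gM g f x (covDerivAlong I J g f (fun x' ↦ mfderiv I J f x' (V x')) x u)

open Classical in
/-- The shape operator: `A_η u` is the vector with `⟨A_η u, v⟩ = ⟨α(u, v), η⟩` for all `v`. -/
def shapeOperator (gM : Π x : M, TangentSpace I x →L[ℝ] TangentSpace I x →L[ℝ] ℝ)
    (g : Π p : P, TangentSpace J p →L[ℝ] TangentSpace J p →L[ℝ] ℝ) (f : M → P) (x : M)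
    (η : TangentSpace J (f x)) (u : TangentSpace I x) : TangentSpace I x :=
  if h : ∃ a : TangentSpace I x, ∀ v : TangentSpace I x,
      gM x a v = g (f x) (secondFundamentalForm I J gM g f x u v) η
  then h.choose else 0

/-- The normal connection `∇^⊥_u η = (∇_u η)^⊥`. -/
def normalConnection (gM : Π x : M, TangentSpace I x →L[ℝ] TangentSpace I x →L[ℝ] ℝ)
    (g : Π p : P, TangentSpace J p →L[ℝ] TangentSpace J p →L[ℝ] ℝ) (f : M → P)
    (η : Π x : M, TangentSpace J (f x)) (x : M) (u : TangentSpace I x) : TangentSpace J (f x) :=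
  normalPart I J gM g f x (covDerivAlong I J g f η x u)

/-- The normal curvature `R^⊥(X, Y)η = ∇^⊥_X ∇^⊥_Y η - ∇^⊥_Y ∇^⊥_X η - ∇^⊥_[X,Y] η`. -/
def normalCurvature (gM : Π x : M, TangentSpace I x →L[ℝ] TangentSpace I x →L[ℝ] ℝ)
    (g : Π p : P, TangentSpace J p →L[ℝ] TangentSpace J p →L[ℝ] ℝ) (f : M → P)
    (X Y : Π x : M, TangentSpace I x) (η : Π x : M, TangentSpace J (f x)) (x : M) :
    TangentSpace J (f x) :=
  normalConnection I J gM g f (fun x' ↦ normalConnection I J gM g f η x' (Y x')) x (X x)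
    - normalConnection I J gM g f (fun x' ↦ normalConnection I J gM g f η x' (X x')) x (Y x)
    - normalConnection I J gM g f η x (VectorField.mlieBracket I X Y x)

end SemiRiemannian

/-! ### The space forms `𝕄^N_λ(c)` -/

section SpaceForm

/-- The signs of the pseudo-Euclidean space `ℝ^{N+1}_ν`: `+1` for the coordinates
`0, …, N - ν`, and `-1` for the last `ν` ones. -/
def pseudoSign (N ν : ℕ) (i : Fin (N + 1)) : ℝ := if (i : ℕ) + ν ≤ N then 1 else -1

/-- The flat metric `g₀ = ∑_{i ≤ N - ν} dx_i² - ∑_{i > N - ν} dx_i²` of `ℝ^{N+1}_ν`. -/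
def pseudoEuclideanForm (N ν : ℕ) :
    EuclideanSpace ℝ (Fin (N + 1)) →L[ℝ] EuclideanSpace ℝ (Fin (N + 1)) →L[ℝ] ℝ :=
  ∑ i, pseudoSign N ν i • (ContinuousLinearMap.mul ℝ ℝ).bilinearComp
    (EuclideanSpace.proj i) (EuclideanSpace.proj i)

/-- The index of the pseudo-Euclidean space `𝔼^{N+1}_λ` around the space form: it is `λ` if `c = 1`
and `λ + 1` if `c = -1`. -/
def ambientIndex (l : ℕ) (c : ℤˣ) : ℕ := if c = 1 then l else l + 1

/-- The hyperquadric `{p ∈ 𝔼^{N+1}_λ : g₀(p, p) = c}`. -/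
@[ext]
structure Hyperquadric (N l : ℕ) (c : ℤˣ) where
  /-- The inclusion into the pseudo-Euclidean space. -/
  point : EuclideanSpace ℝ (Fin (N + 1))
  form_eq : pseudoEuclideanForm N (ambientIndex l c) point point = ((c : ℤ) : ℝ)

namespace Hyperquadric

variable {N l : ℕ} {c : ℤˣ}

/-- The subspace topology. -/
instance : TopologicalSpace (Hyperquadric N l c) := .induced point inferInstance

lemma isInducing_point : Topology.IsInducing (point : Hyperquadric N l c → _) := ⟨rfl⟩

lemma form_apply (N ν : ℕ) (p q : EuclideanSpace ℝ (Fin (N + 1))) :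
    pseudoEuclideanForm N ν p q = ∑ i, pseudoSign N ν i * (p i * q i) := by
  simp [pseudoEuclideanForm]

lemma sign_mul_self (N ν : ℕ) (i : Fin (N + 1)) : pseudoSign N ν i * pseudoSign N ν i = 1 := by
  unfold pseudoSign; split_ifs <;> norm_num

/-- The square of the `i`-th coordinate of a point of the hyperquadric, in terms of its other
coordinates `y`. -/
def sqCoord (l : ℕ) (c : ℤˣ) (i : Fin (N + 1)) (y : EuclideanSpace ℝ (Fin N)) : ℝ :=
  pseudoSign N (ambientIndex l c) i *
    (((c : ℤ) : ℝ) - ∑ j, pseudoSign N (ambientIndex l c) (i.succAbove j) * (y j * y j))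

/-- The point with `i`-th coordinate `σ * √(sqCoord y)` and other coordinates `y`. -/
def graphPoint (l : ℕ) (c : ℤˣ) (i : Fin (N + 1)) (σ : ℝ) (y : EuclideanSpace ℝ (Fin N)) :
    EuclideanSpace ℝ (Fin (N + 1)) :=
  WithLp.toLp 2 (i.insertNth (α := fun _ ↦ ℝ) (σ * √(sqCoord l c i y)) (fun j ↦ y j))

/-- Deleting the `i`-th coordinate. -/
def dropCoord (i : Fin (N + 1)) (p : EuclideanSpace ℝ (Fin (N + 1))) : EuclideanSpace ℝ (Fin N) :=
  WithLp.toLp 2 (fun j ↦ p (i.succAbove j))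

lemma contDiff_sqCoord (i : Fin (N + 1)) : ContDiff ℝ ∞ (sqCoord l c i) := by
  unfold sqCoord; fun_prop

lemma contDiff_dropCoord (i : Fin (N + 1)) : ContDiff ℝ ∞ (dropCoord i) := by
  unfold dropCoord; fun_prop

lemma continuous_graphPoint (i : Fin (N + 1)) (σ : ℝ) : Continuous (graphPoint l c i σ) := by
  have h := (contDiff_sqCoord (l := l) (c := c) i).continuous
  unfold graphPoint
  refine (PiLp.continuous_toLp 2 _).comp (continuous_pi fun k ↦ ?_)
  refine Fin.succAboveCases i ?_ (fun j ↦ ?_) k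
  · simp only [Fin.insertNth_apply_same]; fun_prop
  · simp only [Fin.insertNth_apply_succAbove]; fun_prop

lemma contDiffOn_graphPoint (i : Fin (N + 1)) (σ : ℝ) :
    ContDiffOn ℝ ∞ (graphPoint l c i σ) {y | 0 < sqCoord l c i y} := by
  have h := (contDiff_sqCoord (l := l) (c := c) i).contDiffOn (s := {y | 0 < sqCoord l c i y})
  rw [contDiffOn_euclidean]
  intro k
  unfold graphPoint
  refine Fin.succAboveCases i ?_ (fun j ↦ ?_) k
  · simp only [Fin.insertNth_apply_same]
    exact contDiffOn_const.mul (h.sqrt fun y hy ↦ (ne_of_gt hy))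
  · simp only [Fin.insertNth_apply_succAbove]; fun_prop

lemma graphPoint_mem (i : Fin (N + 1)) {σ : ℝ} (hσ : σ * σ = 1) {y : EuclideanSpace ℝ (Fin N)}
    (hy : 0 < sqCoord l c i y) :
    pseudoEuclideanForm N (ambientIndex l c) (graphPoint l c i σ y) (graphPoint l c i σ y)
      = ((c : ℤ) : ℝ) := by
  rw [form_apply, Fin.sum_univ_succAbove _ i]
  simp only [graphPoint, Fin.insertNth_apply_same, Fin.insertNth_apply_succAbove]
  have h1 : σ * √(sqCoord l c i y) * (σ * √(sqCoord l c i y)) = sqCoord l c i y := by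
    rw [mul_mul_mul_comm, hσ, one_mul, Real.mul_self_sqrt hy.le]
  rw [h1, sqCoord, ← mul_assoc, sign_mul_self]
  ring

lemma sqCoord_dropCoord (i : Fin (N + 1)) (p : Hyperquadric N l c) :
    sqCoord l c i (dropCoord i p.point) = p.point i * p.point i := by
  have h := p.form_eq
  rw [form_apply, Fin.sum_univ_succAbove _ i] at h
  simp only [sqCoord, dropCoord]
  rw [← h, add_sub_cancel_right, ← mul_assoc, sign_mul_self, one_mul]

lemma exists_coord_ne_zero (p : Hyperquadric N l c) : ∃ i, p.point i ≠ 0 := by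
  by_contra! h
  have h2 := p.form_eq
  rw [form_apply] at h2
  simp [h] at h2
  rcases Int.units_eq_one_or c with rfl | rfl <;> norm_num at h2

lemma sqCoord_pos (i : Fin (N + 1)) {σ : ℝ} {p : Hyperquadric N l c} (hp : 0 < σ * p.point i) :
    0 < sqCoord l c i (dropCoord i p.point) := by
  rw [sqCoord_dropCoord]
  exact mul_self_pos.2 (right_ne_zero_of_mul hp.ne')

open Classical in
/-- The inverse of the chart below (with the junk value `p₀` outside its target). -/
def ofGraph (p₀ : Hyperquadric N l c) (i : Fin (N + 1)) (σ : ℝ) (hσ : σ * σ = 1)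
    (y : EuclideanSpace ℝ (Fin N)) : Hyperquadric N l c :=
  if hy : 0 < sqCoord l c i y then ⟨graphPoint l c i σ y, graphPoint_mem i hσ hy⟩ else p₀

lemma ofGraph_point (p₀ : Hyperquadric N l c) (i : Fin (N + 1)) (σ : ℝ) (hσ : σ * σ = 1)
    {y : EuclideanSpace ℝ (Fin N)} (hy : 0 < sqCoord l c i y) :
    (ofGraph p₀ i σ hσ y).point = graphPoint l c i σ y := by
  rw [ofGraph, dif_pos hy]

/-- The chart deleting the `i`-th coordinate, on the part of the hyperquadric where the `i`-th
coordinate has the sign `σ = ±1`. -/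
def chart (p₀ : Hyperquadric N l c) (i : Fin (N + 1)) (σ : ℝ) (hσ : σ * σ = 1) :
    OpenPartialHomeomorph (Hyperquadric N l c) (EuclideanSpace ℝ (Fin N)) where
  toFun p := dropCoord i p.point
  invFun := ofGraph p₀ i σ hσ
  source := {p | 0 < σ * p.point i}
  target := {y | 0 < sqCoord l c i y}
  map_source' _ hp := sqCoord_pos i hp
  map_target' y hy := by
    show 0 < σ * (ofGraph p₀ i σ hσ y).point i
    have h : graphPoint l c i σ y i = σ * √(sqCoord l c i y) := by simp [graphPoint]
    rw [ofGraph_point p₀ i σ hσ hy, h, ← mul_assoc, hσ, one_mul]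
    exact Real.sqrt_pos.2 hy
  left_inv' p hp := by
    have hp : 0 < σ * p.point i := hp
    refine Hyperquadric.ext ?_
    rw [ofGraph_point p₀ i σ hσ (sqCoord_pos i hp)]
    ext k
    simp only [graphPoint, sqCoord_dropCoord]
    refine Fin.succAboveCases i ?_ (fun j ↦ ?_) k
    · simp only [Fin.insertNth_apply_same]
      have : p.point i * p.point i = (σ * p.point i) * (σ * p.point i) := by
        rw [mul_mul_mul_comm, hσ, one_mul]
      rw [this, Real.sqrt_mul_self hp.le, ← mul_assoc, hσ, one_mul]
    · simp only [Fin.insertNth_apply_succAbove, dropCoord]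
  right_inv' y hy := by
    show dropCoord i (ofGraph p₀ i σ hσ y).point = y
    rw [ofGraph_point p₀ i σ hσ hy]
    ext j
    simp [dropCoord, graphPoint]
  open_source := by
    refine isOpen_lt continuous_const (continuous_const.mul ?_)
    exact (EuclideanSpace.proj (𝕜 := ℝ) i).continuous.comp isInducing_point.continuous
  open_target := isOpen_lt continuous_const (contDiff_sqCoord i).continuous
  continuousOn_toFun :=
    ((contDiff_dropCoord i).continuous.comp isInducing_point.continuous).continuousOn
  continuousOn_invFun :=
    isInducing_point.continuousOn_iff.2 <|
      (continuous_graphPoint (l := l) (c := c) i σ).continuousOn.congr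
        fun _ hy ↦ ofGraph_point p₀ i σ hσ hy

/-- The smooth structure of the hyperquadric, as a graph over its coordinate hyperplanes. -/
instance : ChartedSpace (EuclideanSpace ℝ (Fin N)) (Hyperquadric N l c) where
  atlas := {e | ∃ (p₀ : Hyperquadric N l c) (i : Fin (N + 1)) (σ : ℝ) (hσ : σ * σ = 1),
    e = chart p₀ i σ hσ}
  chartAt p := chart p (exists_coord_ne_zero p).choose
    (SignType.sign (p.point (exists_coord_ne_zero p).choose)) (by
      have := (exists_coord_ne_zero p).choose_spec
      rcases lt_or_gt_of_ne this with h | h <;> simp [h])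
  mem_chart_source p := by
    have := (exists_coord_ne_zero p).choose_spec
    show 0 < (SignType.sign (p.point (exists_coord_ne_zero p).choose) : ℝ)
      * p.point (exists_coord_ne_zero p).choose
    rw [_root_.sign_mul_self]
    exact abs_pos.2 this
  chart_mem_atlas p := ⟨_, _, _, _, rfl⟩

instance : IsManifold (𝓡 N) ∞ (Hyperquadric N l c) := by
  refine isManifold_of_contDiffOn _ _ _ ?_
  rintro _ _ ⟨p, i, σ, hσ, rfl⟩ ⟨p', i', σ', hσ', rfl⟩
  have h := (contDiff_dropCoord (N := N) i').comp_contDiffOn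
    (contDiffOn_graphPoint (l := l) (c := c) i σ)
  refine (h.mono ?_).congr ?_
  · rintro y ⟨hy, -⟩
    exact hy.1
  · rintro y ⟨hy, -⟩
    exact congrArg (dropCoord i') (ofGraph_point p i σ hσ hy.1)

instance : LocallyConnectedSpace (Hyperquadric N l c) :=
  ChartedSpace.locallyConnectedSpace (EuclideanSpace ℝ (Fin N)) _

end Hyperquadric

/-- The space form `𝕄^N_λ(c)`: the connected component of `p₀` in the hyperquadric. -/
def spaceForm {N l : ℕ} {c : ℤˣ} (p₀ : Hyperquadric N l c) :
    TopologicalSpace.Opens (Hyperquadric N l c) :=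
  ⟨connectedComponent p₀, isOpen_connectedComponent⟩

end SpaceForm

/-! ### The warped product `εI ×_a 𝕄^N_λ(c)` -/

section WarpedProduct

variable {N l : ℕ} {c : ℤˣ}

/-- The warped product metric `ε dt² + a(t)² g` on `I × 𝕄^N_λ(c)`, where `g` is the metric induced
on `𝕄^N_λ(c)` by the flat metric `g₀` of the surrounding pseudo-Euclidean space. -/
def warpedMetric (ε : ℤˣ) (I : TopologicalSpace.Opens ℝ) (a : ℝ → ℝ) (p₀ : Hyperquadric N l c)
    (p : I × spaceForm p₀) :
    TangentSpace (𝓘(ℝ, ℝ).prod (𝓡 N)) p →L[ℝ] TangentSpace (𝓘(ℝ, ℝ).prod (𝓡 N)) p →L[ℝ] ℝ :=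
  let dt : TangentSpace (𝓘(ℝ, ℝ).prod (𝓡 N)) p →L[ℝ] ℝ :=
    mvfderiv (𝓘(ℝ, ℝ).prod (𝓡 N)) (fun q : I × spaceForm p₀ ↦ (q.1 : ℝ)) p
  let dΞ : TangentSpace (𝓘(ℝ, ℝ).prod (𝓡 N)) p →L[ℝ] EuclideanSpace ℝ (Fin (N + 1)) :=
    mvfderiv (𝓘(ℝ, ℝ).prod (𝓡 N)) (fun q : I × spaceForm p₀ ↦ q.2.1.point) p
  ((ε : ℤ) : ℝ) • (dt.precomp ℝ).comp ((ContinuousLinearMap.mul ℝ ℝ).comp dt)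
    + a p.1 ^ 2 • (dΞ.precomp ℝ).comp ((pseudoEuclideanForm N (ambientIndex l c)).comp dΞ)

end WarpedProduct

end

/-!
Embed the ambient space by `Φ : P → W = ℝ × ℝ^{N+1}`. Along `Φ` its tangent spaces are the kernels
of a one-form `θ` of `W`, its metric is the restriction of a form `G`, and `D + S`, for `D` the flat
derivative of `W` and a suitable symmetric tensor `S`, is compatible with `G` and preserves tangency
to `P`. Hence the Levi-Civita derivative along a map is the flat derivative of the field read in `W`
plus `S`, the second derivatives cancel in the curvature, and what remains is algebraic in `S`.
For the warped product, `R̄(u, v)z` lies in the span of `u` and `v` whenever `z` is orthogonal to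
both. A normal vector `z` is, for `u` and `v` tangent to `M`, so the normal part vanishes, and the
Gauss and Weingarten formulas turn this into the Ricci equation.
-/

noncomputable section

open scoped Topology

section BilinearMaps

variable {V W X : Type*} [NormedAddCommGroup V] [NormedSpace ℝ V] [NormedAddCommGroup W]
  [NormedSpace ℝ W] [NormedAddCommGroup X] [NormedSpace ℝ X]

-- Without these shortcuts, instance search in spaces of bilinear maps exceeds its budget.
instance bilinearMapNormedAddCommGroup : NormedAddCommGroup (V →L[ℝ] W →L[ℝ] X) :=
  ContinuousLinearMap.toNormedAddCommGroup

instance bilinearMapAddCommGroup : AddCommGroup (V →L[ℝ] W →L[ℝ] X) :=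
  ContinuousLinearMap.addCommGroup

end BilinearMaps

section VectorValuedDerivative

variable {E : Type*} [NormedAddCommGroup E] [NormedSpace ℝ E]
  {H : Type*} [TopologicalSpace H] {I : ModelWithCorners ℝ E H}
  {M : Type*} [TopologicalSpace M] [ChartedSpace H M]
  {W : Type*} [NormedAddCommGroup W] [NormedSpace ℝ W]
  {W' : Type*} [NormedAddCommGroup W'] [NormedSpace ℝ W']
  {h h' : M → W} {x : M}

theorem mvfderiv_congr_of_eventuallyEq (hh : h =ᶠ[𝓝 x] h') :
    mvfderiv I h x = mvfderiv I h' x := by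
  ext u
  exact congrArg (fun L : E →L[ℝ] W ↦ L u) (hh.mfderiv_eq (I := I) (I' := 𝓘(ℝ, W)))

theorem mdifferentiableAt_comp_vector {Ψ : W → W'} (hΨ : DifferentiableAt ℝ Ψ (h x))
    (hh : MDifferentiableAt I 𝓘(ℝ, W) h x) :
    MDifferentiableAt I 𝓘(ℝ, W') (fun x' ↦ Ψ (h x')) x :=
  hΨ.mdifferentiableAt.comp x hh

theorem mvfderiv_comp_vector {Ψ : W → W'} (hΨ : DifferentiableAt ℝ Ψ (h x))
    (hh : MDifferentiableAt I 𝓘(ℝ, W) h x) (u : TangentSpace I x) :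
    mvfderiv I (fun x' ↦ Ψ (h x')) x u = fderiv ℝ Ψ (h x) (mvfderiv I h x u) := by
  have := mfderiv_comp_apply x hΨ.mdifferentiableAt hh u
  rw [mfderiv_eq_fderiv] at this
  exact this

theorem mvfderiv_prodMk {k : M → W'}
    (hh : MDifferentiableAt I 𝓘(ℝ, W) h x) (hk : MDifferentiableAt I 𝓘(ℝ, W') k x)
    (u : TangentSpace I x) :
    mvfderiv I (fun x' ↦ (h x', k x')) x u = (mvfderiv I h x u, mvfderiv I k x u) := by
  have hp := hh.prodMk_space hk
  refine Prod.ext ?_ ?_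
  · have := mvfderiv_comp_vector (Ψ := (Prod.fst : W × W' → W)) differentiableAt_fst hp u
    rw [fderiv_fst] at this
    exact this.symm
  · have := mvfderiv_comp_vector (Ψ := (Prod.snd : W × W' → W')) differentiableAt_snd hp u
    rw [fderiv_snd] at this
    exact this.symm

theorem mvfderiv_clm_apply {k : M → W →L[ℝ] W'}
    (hk : MDifferentiableAt I 𝓘(ℝ, W →L[ℝ] W') k x) (hh : MDifferentiableAt I 𝓘(ℝ, W) h x)
    (u : TangentSpace I x) :
    mvfderiv I (fun x' ↦ k x' (h x')) x u = mvfderiv I k x u (h x) + k x (mvfderiv I h x u) := by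
  have hev := (isBoundedBilinearMap_apply (𝕜 := ℝ) (E := W) (F := W')).hasFDerivAt (k x, h x)
  rw [mvfderiv_comp_vector (Ψ := fun p : (W →L[ℝ] W') × W ↦ p.1 p.2) (h := fun x' ↦ (k x', h x'))
    hev.differentiableAt (hk.prodMk_space hh), hev.fderiv, mvfderiv_prodMk hk hh]
  exact add_comm _ _

theorem mdifferentiableAt_of_clm_apply_eq {F : Type*} [NormedAddCommGroup F] [NormedSpace ℝ F]
    [FiniteDimensional ℝ F] [FiniteDimensional ℝ W] {k : M → F →L[ℝ] W} {c : M → F} {b : M → W}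
    (hk : MDifferentiableAt I 𝓘(ℝ, F →L[ℝ] W) k x) (hinj : ∀ v, k x v = 0 → v = 0)
    (hb : MDifferentiableAt I 𝓘(ℝ, W) b x) (hc : ∀ᶠ x' in 𝓝 x, k x' (c x') = b x') :
    MDifferentiableAt I 𝓘(ℝ, F) c x := by
  have : CompleteSpace F := FiniteDimensional.complete ℝ F
  -- With `L` a left inverse of `k x`, the endomorphism `L ∘ k x'` stays invertible near `x`, so
  -- that `c x' = (L ∘ k x')⁻¹ (L (b x'))`.
  obtain ⟨L₀, hL₀⟩ := LinearMap.exists_leftInverse_of_injective (k x : F →ₗ[ℝ] W)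
    (LinearMap.ker_eq_bot'.2 hinj)
  set L : W →L[ℝ] F := LinearMap.toContinuousLinearMap L₀
  have hLk : L.comp (k x) = ((1 : (F →L[ℝ] F)ˣ) : F →L[ℝ] F) := by
    ext v
    exact LinearMap.congr_fun hL₀ v
  have hB : MDifferentiableAt I 𝓘(ℝ, F →L[ℝ] F) (fun x' ↦ L.comp (k x')) x :=
    mdifferentiableAt_comp_vector (Ψ := fun T : F →L[ℝ] W ↦ L.comp T)
      (ContinuousLinearMap.compL ℝ F W F L).differentiableAt hk
  have hBi : MDifferentiableAt I 𝓘(ℝ, F →L[ℝ] F) (fun x' ↦ Ring.inverse (L.comp (k x'))) x :=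
    mdifferentiableAt_comp_vector (Ψ := Ring.inverse) (hLk ▸ differentiableAt_inverse ⟨1, rfl⟩) hB
  have hLb : MDifferentiableAt I 𝓘(ℝ, F) (fun x' ↦ L (b x')) x :=
    mdifferentiableAt_comp_vector L.differentiableAt hb
  have hunit : ∀ᶠ x' in 𝓝 x, IsUnit (L.comp (k x')) :=
    hB.continuousAt.eventually (by
      change {T | IsUnit T} ∈ 𝓝 (L.comp (k x))
      exact hLk ▸ Units.nhds 1)
  refine (hBi.clm_apply hLb).congr_of_eventuallyEq ?_
  filter_upwards [hunit, hc] with x' hx' hcx'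
  rw [← hcx']
  exact (congrArg (fun T : F →L[ℝ] F ↦ T (c x')) (Ring.inverse_mul_cancel _ hx')).symm

end VectorValuedDerivative

section Charts

variable {F : Type*} [NormedAddCommGroup F] [NormedSpace ℝ F]
  {K : Type*} [TopologicalSpace K] {J : ModelWithCorners ℝ F K}
  {P : Type*} [TopologicalSpace P] [ChartedSpace K P] [IsManifold J ∞ P]
  {W : Type*} [NormedAddCommGroup W] [NormedSpace ℝ W]

theorem trivializationAt_snd_eq_mfderiv_extChartAt {p q : P} (hq : q ∈ (chartAt K p).source)
    (v : TangentSpace J q) :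
    (trivializationAt F (TangentSpace J) p (⟨q, v⟩ : TangentBundle J P)).2
      = mfderiv J 𝓘(ℝ, F) (extChartAt J p) q v := by
  rw [← Trivialization.continuousLinearMapAt_apply_of_mem (R := ℝ) _ (by exact hq),
    TangentBundle.continuousLinearMapAt_trivializationAt (I := J) hq]
  rfl

theorem trivializationAt_self_snd (p : P) (v : TangentSpace J p) :
    (trivializationAt F (TangentSpace J) p (⟨p, v⟩ : TangentBundle J P)).2 = v := by
  rw [trivializationAt_snd_eq_mfderiv_extChartAt (mem_chart_source K p), mfderiv_extChartAt_self]
  rfl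

variable (J) in
/-- The map `Φ` read in the preferred chart of its source around `p`. -/
def inChart (Φ : P → W) (p : P) : F → W := Φ ∘ (extChartAt J p).symm

omit [IsManifold J ∞ P] [NormedAddCommGroup W] [NormedSpace ℝ W] in
theorem inChart_self (Φ : P → W) (p : P) : inChart J Φ p (extChartAt J p p) = Φ p :=
  congrArg Φ (extChartAt_to_inv p)

variable [J.Boundaryless] {Φ : P → W}

theorem contDiffAt_inChart {n : ℕ} (p : P) {q : P} (hq : q ∈ (chartAt K p).source)
    (hΦ : ContMDiffAt J 𝓘(ℝ, W) n Φ q) : ContDiffAt ℝ n (inChart J Φ p) (extChartAt J p q) := by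
  have hq' : q ∈ (extChartAt J p).source := by rwa [extChartAt_source]
  have hsymm := (contMDiffOn_extChartAt_symm (I := J) (n := n) p).contMDiffAt
    ((isOpen_extChartAt_target p).mem_nhds ((extChartAt J p).map_source hq'))
  refine contMDiffAt_iff_contDiffAt.1 (ContMDiffAt.comp (extChartAt J p q) ?_ hsymm)
  rwa [(extChartAt J p).left_inv hq']

theorem mvfderiv_eq_fderiv_inChart (p : P) {q : P} (hq : q ∈ (chartAt K p).source)
    (hΦ : ContMDiffAt J 𝓘(ℝ, W) 1 Φ q) (v : TangentSpace J q) :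
    mvfderiv J Φ q v = fderiv ℝ (inChart J Φ p) (extChartAt J p q)
      (trivializationAt F (TangentSpace J) p (⟨q, v⟩ : TangentBundle J P)).2 := by
  have hΦ_eq : Φ =ᶠ[𝓝 q] fun q' ↦ inChart J Φ p (extChartAt J p q') := by
    filter_upwards [(isOpen_extChartAt_source (I := J) p).mem_nhds (by rwa [extChartAt_source])]
      with q' hq'
    exact (congrArg Φ ((extChartAt J p).left_inv hq')).symm
  have hd := (contDiffAt_inChart (n := 1) p hq hΦ).differentiableAt (by simp)
  rw [mvfderiv_congr_of_eventuallyEq hΦ_eq,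
    mvfderiv_comp_vector hd (mdifferentiableAt_extChartAt hq),
    trivializationAt_snd_eq_mfderiv_extChartAt hq]
  rfl

theorem mvfderiv_eq_fderiv_inChart_self {p : P} (hΦ : ContMDiffAt J 𝓘(ℝ, W) 1 Φ p)
    (v : TangentSpace J p) :
    mvfderiv J Φ p v = fderiv ℝ (inChart J Φ p) (extChartAt J p p) v := by
  rw [mvfderiv_eq_fderiv_inChart p (mem_chart_source K p) hΦ, trivializationAt_self_snd]

theorem fderiv_inChart_eq_mvfderiv (p : P) {y : F} (hy : y ∈ (extChartAt J p).target)
    (hΦ : ContMDiffAt J 𝓘(ℝ, W) 1 Φ ((extChartAt J p).symm y)) (v : F) :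
    fderiv ℝ (inChart J Φ p) y v = mvfderiv J Φ ((extChartAt J p).symm y)
      ((trivializationAt F (TangentSpace J) p).symmL ℝ ((extChartAt J p).symm y) v) := by
  have hq : (extChartAt J p).symm y ∈ (chartAt K p).source := by
    rw [← extChartAt_source J]; exact (extChartAt J p).map_target hy
  rw [mvfderiv_eq_fderiv_inChart p hq hΦ, (extChartAt J p).right_inv hy]
  congr 1
  rw [← Trivialization.continuousLinearMapAt_apply_of_mem (R := ℝ) _ (by exact hq)]
  exact (Trivialization.continuousLinearMapAt_symmL (R := ℝ) _ (by exact hq) v).symm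

theorem differentiableAt_fderiv_inChart {p : P} (hΦ : ContMDiffAt J 𝓘(ℝ, W) 2 Φ p) :
    DifferentiableAt ℝ (fderiv ℝ (inChart J Φ p)) (extChartAt J p p) :=
  ((contDiffAt_inChart (n := 2) p (mem_chart_source K p) hΦ).fderiv_right (m := 1)
    (by norm_num)).differentiableAt (by simp)

end Charts

section AlongMap

variable {E : Type*} [NormedAddCommGroup E] [NormedSpace ℝ E]
  {H : Type*} [TopologicalSpace H] {I : ModelWithCorners ℝ E H}
  {M : Type*} [TopologicalSpace M] [ChartedSpace H M]
  {F : Type*} [NormedAddCommGroup F] [NormedSpace ℝ F]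
  {K : Type*} [TopologicalSpace K] {J : ModelWithCorners ℝ F K}
  {P : Type*} [TopologicalSpace P] [ChartedSpace K P] [IsManifold J ∞ P]
  {W : Type*} [NormedAddCommGroup W] [NormedSpace ℝ W]

variable (J) in
/-- The components, in the preferred chart around `p`, of the vector field `V` along `f`. -/
def compAlong {f : M → P} (p : P) (V : Π x : M, TangentSpace J (f x)) (x : M) : F :=
  (trivializationAt F (TangentSpace J) p (⟨f x, V x⟩ : TangentBundle J P)).2

variable (J) in
/-- The vector field `V` along `f`, seen through the map `Φ` into a vector space. -/
def ambientField (Φ : P → W) {f : M → P} (V : Π x : M, TangentSpace J (f x)) (x : M) : W :=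
  mvfderiv J Φ (f x) (V x)

variable {f : M → P} {V : Π x : M, TangentSpace J (f x)} {Φ : P → W} {x : M}

omit [TopologicalSpace M] in
theorem compAlong_self : compAlong J (f x) V x = V x :=
  trivializationAt_self_snd (f x) (V x)

theorem mdifferentiableAt_extChartAt_comp (hf : MDifferentiableAt I J f x) :
    MDifferentiableAt I 𝓘(ℝ, F) (fun x' ↦ extChartAt J (f x) (f x')) x :=
  (mdifferentiableAt_extChartAt (mem_chart_source K (f x))).comp x hf

theorem mvfderiv_extChartAt_comp (hf : MDifferentiableAt I J f x) (u : TangentSpace I x) :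
    mvfderiv I (fun x' ↦ extChartAt J (f x) (f x')) x u = mfderiv I J f x u := by
  have := mfderiv_comp_apply x
    (mdifferentiableAt_extChartAt (I := J) (mem_chart_source K (f x))) hf u
  rwa [mfderiv_extChartAt_self] at this

theorem contMDiffAt_ambientField {n : ℕ} (hΦ : ContMDiff J 𝓘(ℝ, W) (n + 1 : ℕ) Φ)
    (hV : ContMDiffAt I J.tangent n (fun x' ↦ (⟨f x', V x'⟩ : TangentBundle J P)) x) :
    ContMDiffAt I 𝓘(ℝ, W) n (ambientField J Φ V) x :=
  (contMDiff_snd_tangentBundle_modelSpace W 𝓘(ℝ, W)).contMDiffAt.comp x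
    ((hΦ.contMDiff_tangentMap (m := n) le_rfl).contMDiffAt.comp x hV)

variable [J.Boundaryless]

theorem ambientField_eventuallyEq (hΦ : ContMDiffAt J 𝓘(ℝ, W) 1 Φ (f x))
    (hf : ContinuousAt f x) :
    (ambientField J Φ V) =ᶠ[𝓝 x] fun x' ↦
      fderiv ℝ (inChart J Φ (f x)) (extChartAt J (f x) (f x')) (compAlong J (f x) V x') := by
  filter_upwards [hf.eventually ((chartAt K (f x)).open_source.mem_nhds
    (mem_chart_source K (f x))),
    hf.eventually ((contMDiffAt_iff_contMDiffAt_nhds (by simp)).1 hΦ)] with x' hx' hΦ'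
  exact mvfderiv_eq_fderiv_inChart (f x) hx' hΦ' (V x')

theorem mdifferentiableAt_fderiv_inChart_comp (hΦ : ContMDiffAt J 𝓘(ℝ, W) 2 Φ (f x))
    (hf : MDifferentiableAt I J f x) :
    MDifferentiableAt I 𝓘(ℝ, F →L[ℝ] W)
      (fun x' ↦ fderiv ℝ (inChart J Φ (f x)) (extChartAt J (f x) (f x'))) x :=
  mdifferentiableAt_comp_vector (differentiableAt_fderiv_inChart hΦ)
    (mdifferentiableAt_extChartAt_comp hf)

theorem mdifferentiableAt_ambientField (hΦ : ContMDiffAt J 𝓘(ℝ, W) 2 Φ (f x))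
    (hf : MDifferentiableAt I J f x)
    (hV : MDifferentiableAt I 𝓘(ℝ, F) (compAlong J (f x) V) x) :
    MDifferentiableAt I 𝓘(ℝ, W) (ambientField J Φ V) x :=
  ((mdifferentiableAt_fderiv_inChart_comp hΦ hf).clm_apply hV).congr_of_eventuallyEq
    (ambientField_eventuallyEq (hΦ.of_le one_le_two) hf.continuousAt)

theorem mdifferentiableAt_compAlong [FiniteDimensional ℝ F] [FiniteDimensional ℝ W]
    (hΦ : ContMDiffAt J 𝓘(ℝ, W) 2 Φ (f x)) (hf : MDifferentiableAt I J f x)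
    (hinj : ∀ v, mvfderiv J Φ (f x) v = 0 → v = 0)
    (hV : MDifferentiableAt I 𝓘(ℝ, W) (ambientField J Φ V) x) :
    MDifferentiableAt I 𝓘(ℝ, F) (compAlong J (f x) V) x :=
  mdifferentiableAt_of_clm_apply_eq (mdifferentiableAt_fderiv_inChart_comp hΦ hf)
    (fun v hv ↦ hinj v
      ((mvfderiv_eq_fderiv_inChart_self (hΦ.of_le one_le_two) v).trans hv)) hV
    (ambientField_eventuallyEq (hΦ.of_le one_le_two) hf.continuousAt).symm

theorem mvfderiv_ambientField (hΦ : ContMDiffAt J 𝓘(ℝ, W) 2 Φ (f x))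
    (hf : MDifferentiableAt I J f x)
    (hV : MDifferentiableAt I 𝓘(ℝ, F) (compAlong J (f x) V) x) (u : TangentSpace I x) :
    mvfderiv I (ambientField J Φ V) x u
      = fderiv ℝ (fderiv ℝ (inChart J Φ (f x))) (extChartAt J (f x) (f x))
          (mfderiv I J f x u) (V x)
        + mvfderiv J Φ (f x) (mvfderiv I (compAlong J (f x) V) x u) := by
  have hΦ1 := hΦ.of_le one_le_two
  rw [mvfderiv_congr_of_eventuallyEq (ambientField_eventuallyEq hΦ1 hf.continuousAt)]
  refine (mvfderiv_clm_apply (mdifferentiableAt_fderiv_inChart_comp hΦ hf) hV u).trans ?_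
  rw [mvfderiv_comp_vector (h := fun x' ↦ extChartAt J (f x) (f x'))
    (differentiableAt_fderiv_inChart hΦ) (mdifferentiableAt_extChartAt_comp hf),
    mvfderiv_extChartAt_comp hf, compAlong_self]
  exact congrArg _ (mvfderiv_eq_fderiv_inChart_self hΦ1 _).symm

end AlongMap

section Christoffel

variable {F : Type*} [NormedAddCommGroup F] [NormedSpace ℝ F]
  {K : Type*} [TopologicalSpace K] {J : ModelWithCorners ℝ F K}
  {P : Type*} [TopologicalSpace P] [ChartedSpace K P]

theorem isInvertible_of_forall_apply_eq_zero [FiniteDimensional ℝ F] {m : F →L[ℝ] F →L[ℝ] ℝ}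
    (hm : ∀ u, (∀ v, m u v = 0) → u = 0) : m.IsInvertible := by
  have hfr : Module.finrank ℝ F = Module.finrank ℝ (F →L[ℝ] ℝ) := by
    rw [← (LinearMap.toContinuousLinearMap (𝕜 := ℝ) (E := F) (F' := ℝ)).finrank_eq]
    exact (Subspace.dual_finrank_eq (K := ℝ) (V := F)).symm
  have hinj : Function.Injective m :=
    (injective_iff_map_eq_zero m).2 fun u hu ↦ hm u fun v ↦ by simp [hu]
  exact ⟨(LinearEquiv.ofInjectiveOfFinrankEq (m : F →ₗ[ℝ] (F →L[ℝ] ℝ))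
    hinj hfr).toContinuousLinearEquiv, by ext; rfl⟩

variable [IsManifold J ∞ P] {g : Π p : P, TangentSpace J p →L[ℝ] TangentSpace J p →L[ℝ] ℝ}

theorem metricInChart_self (p : P) (u v : TangentSpace J p) :
    metricInChart J g p (extChartAt J p p) u v = g p u v := by
  have hsymmL (w : TangentSpace J p) :
      (trivializationAt F (TangentSpace J) p).symmL ℝ p (w : F) = w := by
    have hw := Trivialization.symmL_continuousLinearMapAt (R := ℝ)
      (trivializationAt F (TangentSpace J) p) (mem_chart_source K p) w
    rwa [Trivialization.continuousLinearMapAt_apply_of_mem (R := ℝ) _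
      (by exact mem_chart_source K p), trivializationAt_self_snd] at hw
  suffices ∀ q, q = p → g q ((trivializationAt F (TangentSpace J) p).symmL ℝ q u)
      ((trivializationAt F (TangentSpace J) p).symmL ℝ q v) = g p u v from
    this _ (extChartAt_to_inv p)
  rintro _ rfl
  exact congrArg₂ (fun u v ↦ g _ u v) (hsymmL u) (hsymmL v)

theorem christoffel_eq [FiniteDimensional ℝ F] {p : P}
    (hg : ∀ u : TangentSpace J p, (∀ v, g p u v = 0) → u = 0) {u v q : F}
    (hq : ∀ w : F, 2 * metricInChart J g p (extChartAt J p p) q w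
      = fderiv ℝ (metricInChart J g p) (extChartAt J p p) u v w
        + fderiv ℝ (metricInChart J g p) (extChartAt J p p) v u w
        - fderiv ℝ (metricInChart J g p) (extChartAt J p p) w u v) :
    christoffel J g p (extChartAt J p p) u v = q := by
  have hinv : (metricInChart J g p (extChartAt J p p)).IsInvertible :=
    isInvertible_of_forall_apply_eq_zero fun u hu ↦
      hg u fun v ↦ (metricInChart_self p u v).symm.trans (hu v)
  refine hinv.inverse_apply_eq.2 (ContinuousLinearMap.ext fun w ↦ ?_)
  simp only [smul_apply, sub_apply, add_apply, ContinuousLinearMap.flip_apply, smul_eq_mul, ← hq]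
  ring

end Christoffel

section ChartDerivatives

theorem differentiableAt_precomp {F : Type*} [NormedAddCommGroup F] [NormedSpace ℝ F]
    {W : Type*} [NormedAddCommGroup W] [NormedSpace ℝ W] {A : F → F →L[ℝ] W} {y : F}
    (hA : DifferentiableAt ℝ A y) :
    DifferentiableAt ℝ (fun y ↦ ((A y).precomp ℝ : (W →L[ℝ] ℝ) →L[ℝ] F →L[ℝ] ℝ)) y := by
  have hcompL := (ContinuousLinearMap.compL ℝ F W ℝ).flip.differentiableAt (x := A y)
  exact DifferentiableAt.comp (F := F →L[ℝ] W) (G := (W →L[ℝ] ℝ) →L[ℝ] F →L[ℝ] ℝ) y hcompL hA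

variable {F : Type*} [NormedAddCommGroup F] [NormedSpace ℝ F]
  {K : Type*} [TopologicalSpace K] {J : ModelWithCorners ℝ F K} [J.Boundaryless]
  {P : Type*} [TopologicalSpace P] [ChartedSpace K P] [IsManifold J ∞ P]
  {W : Type*} [NormedAddCommGroup W] [NormedSpace ℝ W] {Φ : P → W}

theorem hasFDerivAt_comp_inChart {W' : Type*} [NormedAddCommGroup W']
    [NormedSpace ℝ W'] {p : P} (hΦ : ContMDiffAt J 𝓘(ℝ, W) 1 Φ p) {Ψ : W → W'}
    (hΨ : DifferentiableAt ℝ Ψ (Φ p)) :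
    HasFDerivAt (fun y ↦ Ψ (inChart J Φ p y))
      ((fderiv ℝ Ψ (Φ p)).comp (fderiv ℝ (inChart J Φ p) (extChartAt J p p)))
      (extChartAt J p p) := by
  rw [← inChart_self (J := J) Φ p] at hΨ ⊢
  exact hΨ.hasFDerivAt.comp _ ((contDiffAt_inChart (n := 1) p (mem_chart_source K p)
    hΦ).differentiableAt (by simp)).hasFDerivAt

theorem hasFDerivAt_fderiv_inChart_apply {p : P} (hΦ : ContMDiffAt J 𝓘(ℝ, W) 2 Φ p) (v : F) :
    HasFDerivAt (fun y ↦ fderiv ℝ (inChart J Φ p) y v)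
      ((fderiv ℝ (fderiv ℝ (inChart J Φ p)) (extChartAt J p p)).flip v) (extChartAt J p p) := by
  have := (differentiableAt_fderiv_inChart hΦ).hasFDerivAt.clm_apply (hasFDerivAt_const v _)
  rwa [ContinuousLinearMap.comp_zero, zero_add] at this

end ChartDerivatives

section AmbientModel

variable {F : Type*} [NormedAddCommGroup F] [NormedSpace ℝ F]
  {K : Type*} [TopologicalSpace K] {J : ModelWithCorners ℝ F K}
  {P : Type*} [TopologicalSpace P] [ChartedSpace K P]
  {W : Type*} [NormedAddCommGroup W] [NormedSpace ℝ W]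

variable (J) in
/-- `Φ` is an immersion of `(P, g)` in a vector space `W`, whose tangent spaces are the kernels of
the `1`-form `θ`. The metric `g` is induced by the bilinear forms `G`, and along `Φ` the connection
`D + S` of `W` is torsion-free, compatible with `G`, and preserves tangency to `Φ`. -/
structure IsAmbientModel
    (g : Π p : P, TangentSpace J p →L[ℝ] TangentSpace J p →L[ℝ] ℝ) (Φ : P → W)
    (G : W → W →L[ℝ] W →L[ℝ] ℝ) (θ : W → W →L[ℝ] ℝ) (S : W → W →L[ℝ] W →L[ℝ] W) : Prop where
  contMDiff : ContMDiff J 𝓘(ℝ, W) ∞ Φ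
  metric_eq : ∀ (p : P) (u v : TangentSpace J p),
    g p u v = G (Φ p) (mvfderiv J Φ p u) (mvfderiv J Φ p v)
  nondegenerate : ∀ (p : P) (u : TangentSpace J p), (∀ v, g p u v = 0) → u = 0
  form_tangent : ∀ (p : P) (u : TangentSpace J p), θ (Φ p) (mvfderiv J Φ p u) = 0
  exists_tangent : ∀ (p : P) (z : W), θ (Φ p) z = 0 → ∃ u, mvfderiv J Φ p u = z
  differentiableAt_metric : ∀ p : P, DifferentiableAt ℝ G (Φ p)
  differentiableAt_form : ∀ p : P, DifferentiableAt ℝ θ (Φ p)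
  differentiableAt_connection : ∀ p : P, DifferentiableAt ℝ S (Φ p)
  metric_symm : ∀ w z z', G w z z' = G w z' z
  connection_symm : ∀ w z z', S w z z' = S w z' z
  metric_compatible : ∀ (p : P) (z₁ z₂ z₃ : W), θ (Φ p) z₁ = 0 → θ (Φ p) z₂ = 0 →
    θ (Φ p) z₃ = 0 →
    fderiv ℝ G (Φ p) z₁ z₂ z₃ = G (Φ p) (S (Φ p) z₁ z₂) z₃ + G (Φ p) z₂ (S (Φ p) z₁ z₃)
  tangent_compatible : ∀ (p : P) (z₁ z₂ : W), θ (Φ p) z₁ = 0 → θ (Φ p) z₂ = 0 →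
    θ (Φ p) (S (Φ p) z₁ z₂) = fderiv ℝ θ (Φ p) z₁ z₂

variable (J) in
/-- The Hessian of `Φ : P → W` at `p` for the connection `D + S` of `W`, where `P` carries the flat
connection of the preferred chart around `p`. For an ambient model it is the tangent vector to `Φ`
representing the Christoffel symbols of `P`. -/
def ambientHessian (Φ : P → W) (S : W → W →L[ℝ] W →L[ℝ] W) (p : P) (u v : TangentSpace J p) : W :=
  fderiv ℝ (fderiv ℝ (inChart J Φ p)) (extChartAt J p p) u v
    + S (Φ p) (mvfderiv J Φ p u) (mvfderiv J Φ p v)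

variable {g : Π p : P, TangentSpace J p →L[ℝ] TangentSpace J p →L[ℝ] ℝ} {Φ : P → W}
  {G : W → W →L[ℝ] W →L[ℝ] ℝ} {θ : W → W →L[ℝ] ℝ} {S : W → W →L[ℝ] W →L[ℝ] W}

theorem ambientHessian_symm [IsManifold J ∞ P] [J.Boundaryless] {p : P}
    (hΦ : ContMDiffAt J 𝓘(ℝ, W) 2 Φ p) (hS : ∀ w z z', S w z z' = S w z' z)
    (u v : TangentSpace J p) :
    ambientHessian J Φ S p u v = ambientHessian J Φ S p v u :=
  congrArg₂ (· + ·)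
    (((contDiffAt_inChart (n := 2) p (mem_chart_source K p) hΦ).isSymmSndFDerivAt
      (by simp)).eq u v)
    (hS _ _ _)

namespace IsAmbientModel

theorem injective (h : IsAmbientModel J g Φ G θ S) (p : P) (u : TangentSpace J p)
    (hu : mvfderiv J Φ p u = 0) : u = 0 :=
  h.nondegenerate p u fun v ↦ by rw [h.metric_eq, hu]; simp

theorem contMDiffAt {n : ℕ} (h : IsAmbientModel J g Φ G θ S) (p : P) :
    ContMDiffAt J 𝓘(ℝ, W) n Φ p :=
  (h.contMDiff p).of_le (mod_cast le_top)

variable [IsManifold J ∞ P] [J.Boundaryless]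

theorem metricInChart_eventuallyEq (h : IsAmbientModel J g Φ G θ S) (p : P) :
    metricInChart J g p =ᶠ[𝓝 (extChartAt J p p)] fun y ↦
      ((fderiv ℝ (inChart J Φ p) y).precomp ℝ).comp
        ((G (inChart J Φ p y)).comp (fderiv ℝ (inChart J Φ p) y)) := by
  filter_upwards [extChartAt_target_mem_nhds (I := J) p] with y hy
  ext v w
  change _ = G (inChart J Φ p y) (fderiv ℝ (inChart J Φ p) y v) (fderiv ℝ (inChart J Φ p) y w)
  rw [fderiv_inChart_eq_mvfderiv p hy (h.contMDiffAt _),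
    fderiv_inChart_eq_mvfderiv p hy (h.contMDiffAt _)]
  exact h.metric_eq _ _ _

theorem form_fderiv_inChart_eventuallyEq (h : IsAmbientModel J g Φ G θ S) (p : P) (v : F) :
    (fun y ↦ θ (inChart J Φ p y) (fderiv ℝ (inChart J Φ p) y v))
      =ᶠ[𝓝 (extChartAt J p p)] fun _ ↦ 0 := by
  filter_upwards [extChartAt_target_mem_nhds (I := J) p] with y hy
  rw [fderiv_inChart_eq_mvfderiv p hy (h.contMDiffAt _)]
  exact h.form_tangent _ _

theorem form_ambientHessian (h : IsAmbientModel J g Φ G θ S) (p : P) (u v : TangentSpace J p) :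
    θ (Φ p) (ambientHessian J Φ S p u v) = 0 := by
  have hderiv := (hasFDerivAt_comp_inChart (h.contMDiffAt p) (h.differentiableAt_form p)).clm_apply
    (hasFDerivAt_fderiv_inChart_apply (h.contMDiffAt p) v)
  have hu := congrArg (fun L : F →L[ℝ] ℝ ↦ L u) (hderiv.unique
    ((hasFDerivAt_const 0 _).congr_of_eventuallyEq (h.form_fderiv_inChart_eventuallyEq p v)))
  rw [ambientHessian, map_add, h.tangent_compatible p _ _ (h.form_tangent p u)
    (h.form_tangent p v), mvfderiv_eq_fderiv_inChart_self (h.contMDiffAt p),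
    mvfderiv_eq_fderiv_inChart_self (h.contMDiffAt p)]
  rw [inChart_self] at hu
  exact hu

theorem metricInChart_apply_eventuallyEq (h : IsAmbientModel J g Φ G θ S) (p : P) (v w : F) :
    (fun y ↦ metricInChart J g p y v w) =ᶠ[𝓝 (extChartAt J p p)] fun y ↦
      G (inChart J Φ p y) (fderiv ℝ (inChart J Φ p) y v) (fderiv ℝ (inChart J Φ p) y w) :=
  (h.metricInChart_eventuallyEq p).mono fun _ hy ↦
    congrArg (fun m : F →L[ℝ] F →L[ℝ] ℝ ↦ m v w) hy

theorem differentiableAt_metricInChart (h : IsAmbientModel J g Φ G θ S) (p : P) :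
    DifferentiableAt ℝ (metricInChart J g p) (extChartAt J p p) := by
  have hG := (hasFDerivAt_comp_inChart (W' := W →L[ℝ] W →L[ℝ] ℝ) (h.contMDiffAt p)
    (h.differentiableAt_metric p)).differentiableAt
  have hdΦ := differentiableAt_fderiv_inChart (h.contMDiffAt p)
  exact ((differentiableAt_precomp hdΦ).clm_comp (hG.clm_comp hdΦ)).congr_of_eventuallyEq
    (h.metricInChart_eventuallyEq p)

theorem fderiv_metricInChart_apply (h : IsAmbientModel J g Φ G θ S) (p : P) (u v w : F) :
    fderiv ℝ (metricInChart J g p) (extChartAt J p p) u v w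
      = fderiv ℝ G (Φ p) (fderiv ℝ (inChart J Φ p) (extChartAt J p p) u)
          (fderiv ℝ (inChart J Φ p) (extChartAt J p p) v)
          (fderiv ℝ (inChart J Φ p) (extChartAt J p p) w)
        + G (Φ p) (fderiv ℝ (fderiv ℝ (inChart J Φ p)) (extChartAt J p p) u v)
          (fderiv ℝ (inChart J Φ p) (extChartAt J p p) w)
        + G (Φ p) (fderiv ℝ (inChart J Φ p) (extChartAt J p p) v)
          (fderiv ℝ (fderiv ℝ (inChart J Φ p)) (extChartAt J p p) u w) := by
  have hlhs := ((h.differentiableAt_metricInChart p).hasFDerivAt.clm_apply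
    (hasFDerivAt_const v _)).clm_apply (hasFDerivAt_const w _)
  have hrhs := ((hasFDerivAt_comp_inChart (W' := W →L[ℝ] W →L[ℝ] ℝ) (h.contMDiffAt p)
    (h.differentiableAt_metric p)).clm_apply
      (hasFDerivAt_fderiv_inChart_apply (h.contMDiffAt p) v)).clm_apply
    (hasFDerivAt_fderiv_inChart_apply (h.contMDiffAt p) w)
  have hu := congrArg (fun L : F →L[ℝ] ℝ ↦ L u)
    (hlhs.unique (hrhs.congr_of_eventuallyEq (h.metricInChart_apply_eventuallyEq p v w)))
  simp only [ContinuousLinearMap.comp_zero, zero_add, add_apply, ContinuousLinearMap.comp_apply,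
    ContinuousLinearMap.flip_apply, inChart_self] at hu
  rw [hu]
  ring

theorem fderiv_metricInChart (h : IsAmbientModel J g Φ G θ S) (p : P) (u v w : TangentSpace J p) :
    fderiv ℝ (metricInChart J g p) (extChartAt J p p) u v w
      = G (Φ p) (ambientHessian J Φ S p u v) (mvfderiv J Φ p w)
        + G (Φ p) (mvfderiv J Φ p v) (ambientHessian J Φ S p u w) := by
  rw [h.fderiv_metricInChart_apply p u v w]
  simp only [← mvfderiv_eq_fderiv_inChart_self (h.contMDiffAt p)]
  rw [h.metric_compatible p _ _ _ (h.form_tangent p u) (h.form_tangent p v) (h.form_tangent p w),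
    ambientHessian, ambientHessian, map_add, map_add, add_apply]
  ring

theorem mvfderiv_christoffel [FiniteDimensional ℝ F] (h : IsAmbientModel J g Φ G θ S)
    (p : P) (u v : TangentSpace J p) :
    mvfderiv J Φ p (christoffel J g p (extChartAt J p p) u v : F) = ambientHessian J Φ S p u v := by
  have hsymm := ambientHessian_symm (h.contMDiffAt (n := 2) p) h.connection_symm
  obtain ⟨q, hq⟩ := h.exists_tangent p _ (h.form_ambientHessian p u v)
  rw [← hq]
  congr 1
  refine christoffel_eq (h.nondegenerate p) fun w ↦ ?_
  have hqw : metricInChart J g p (extChartAt J p p) q w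
      = G (Φ p) (ambientHessian J Φ S p u v) (mvfderiv J Φ p w) := by
    rw [← hq]
    exact (metricInChart_self p q w).trans (h.metric_eq p q w)
  rw [hqw, h.fderiv_metricInChart p u v w, h.fderiv_metricInChart p v u w,
    h.fderiv_metricInChart p w u v, hsymm v u, hsymm w u, hsymm w v,
    h.metric_symm _ (mvfderiv J Φ p v) (ambientHessian J Φ S p u w)]
  ring

variable {E : Type*} [NormedAddCommGroup E] [NormedSpace ℝ E]
  {H : Type*} [TopologicalSpace H] {I : ModelWithCorners ℝ E H}
  {M : Type*} [TopologicalSpace M] [ChartedSpace H M]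
  {f : M → P} {V : Π x : M, TangentSpace J (f x)} {x : M}

omit [IsManifold J ∞ P] [J.Boundaryless] in
theorem mvfderiv_mfderiv (h : IsAmbientModel J g Φ G θ S) (hf : MDifferentiableAt I J f x)
    (u : TangentSpace I x) :
    mvfderiv J Φ (f x) (mfderiv I J f x u) = mvfderiv I (fun x' ↦ Φ (f x')) x u :=
  (mfderiv_comp_apply x ((h.contMDiff (f x)).mdifferentiableAt (by simp)) hf u).symm

theorem mvfderiv_covDerivAlong [FiniteDimensional ℝ F] [FiniteDimensional ℝ W]
    (h : IsAmbientModel J g Φ G θ S) (hf : MDifferentiableAt I J f x)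
    (hV : MDifferentiableAt I 𝓘(ℝ, W) (ambientField J Φ V) x) (u : TangentSpace I x) :
    mvfderiv J Φ (f x) (covDerivAlong I J g f V x u)
      = mvfderiv I (ambientField J Φ V) x u
        + S (Φ (f x)) (mvfderiv I (fun x' ↦ Φ (f x')) x u) (ambientField J Φ V x) := by
  have hcomp := mdifferentiableAt_compAlong (h.contMDiffAt _) hf (h.injective (f x)) hV
  have hsplit : mvfderiv J Φ (f x) (covDerivAlong I J g f V x u)
      = mvfderiv J Φ (f x) (mvfderiv I (compAlong J (f x) V) x u : F)
        + mvfderiv J Φ (f x)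
          (christoffel J g (f x) (extChartAt J (f x) (f x)) (mfderiv I J f x u) (V x) : F) :=
    (mvfderiv J Φ (f x)).map_add _ _
  rw [mvfderiv_ambientField (h.contMDiffAt _) hf hcomp, hsplit, h.mvfderiv_christoffel,
    ambientHessian, h.mvfderiv_mfderiv hf, ambientField]
  abel

end IsAmbientModel

end AmbientModel

section LieBracket

variable {E : Type*} [NormedAddCommGroup E] [NormedSpace ℝ E]
  {H : Type*} [TopologicalSpace H] {I : ModelWithCorners ℝ E H}
  {M : Type*} [TopologicalSpace M] [ChartedSpace H M] [IsManifold I ∞ M]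
  {W : Type*} [NormedAddCommGroup W] [NormedSpace ℝ W]
  {X Y Z : Π x : M, TangentSpace I x} {h : M → W} {x : M}

variable (I) in
/-- The vector field `Z` in the preferred chart around `x`, as a function of the coordinates. -/
def fieldInChart (x : M) (Z : Π x : M, TangentSpace I x) (y : E) : E :=
  VectorField.mpullbackWithin 𝓘(ℝ, E) I (extChartAt I x).symm Z (Set.range I) y

theorem fieldInChart_eq_compAlong {y : E} (hy : y ∈ (extChartAt I x).target) :
    fieldInChart I x Z y = compAlong I (f := id) x Z ((extChartAt I x).symm y) := by
  have hq : (extChartAt I x).symm y ∈ (chartAt H x).source := by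
    rw [← extChartAt_source I]; exact (extChartAt I x).map_target hy
  rw [compAlong, id, trivializationAt_snd_eq_mfderiv_extChartAt hq, fieldInChart,
    VectorField.mpullbackWithin_apply,
    ContinuousLinearMap.inverse_eq (mfderivWithin_extChartAt_symm_comp_mfderiv_extChartAt hy)
      (mfderiv_extChartAt_comp_mfderivWithin_extChartAt_symm hy)]
  rfl

theorem fieldInChart_self (x : M) (Z : Π x : M, TangentSpace I x) :
    fieldInChart I x Z (extChartAt I x x) = Z x := by
  rw [fieldInChart_eq_compAlong (mem_extChartAt_target x), extChartAt_to_inv]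
  exact compAlong_self (f := id)

variable [I.Boundaryless]

theorem mvfderiv_compAlong_id [CompleteSpace E]
    (hZ : MDifferentiableAt I I.tangent (fun x' ↦ (⟨x', Z x'⟩ : TangentBundle I M)) x)
    (u : TangentSpace I x) :
    mvfderiv I (compAlong I (f := id) x Z) x u
      = fderiv ℝ (fieldInChart I x Z) (extChartAt I x x) u := by
  have hd : DifferentiableAt ℝ (fieldInChart I x Z) (extChartAt I x x) := by
    have hZ' := hZ.mdifferentiableWithinAt (s := Set.univ)
      |>.differentiableWithinAt_mpullbackWithin_vectorField
    rw [Set.preimage_univ, Set.univ_inter, I.range_eq_univ] at hZ'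
    unfold fieldInChart
    rw [I.range_eq_univ]
    exact hZ'.differentiableAt Filter.univ_mem
  have heq : compAlong I (f := id) x Z =ᶠ[𝓝 x] fun x' ↦ fieldInChart I x Z (extChartAt I x x') := by
    filter_upwards [extChartAt_source_mem_nhds (I := I) x] with x' hx'
    rw [fieldInChart_eq_compAlong ((extChartAt I x).map_source hx'), (extChartAt I x).left_inv hx']
  rw [mvfderiv_congr_of_eventuallyEq heq,
    mvfderiv_comp_vector hd (mdifferentiableAt_extChartAt (mem_chart_source H x))]
  have hid := mvfderiv_extChartAt_comp (f := id) (mdifferentiableAt_id (I := I) (x := x)) u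
  rw [mfderiv_id] at hid
  exact congrArg _ hid

theorem mlieBracket_eq_sub [CompleteSpace E]
    (hX : MDifferentiableAt I I.tangent (fun x' ↦ (⟨x', X x'⟩ : TangentBundle I M)) x)
    (hY : MDifferentiableAt I I.tangent (fun x' ↦ (⟨x', Y x'⟩ : TangentBundle I M)) x) :
    VectorField.mlieBracket I X Y x = (mvfderiv I (compAlong I (f := id) x Y) x (X x)
      - mvfderiv I (compAlong I (f := id) x X) x (Y x) : E) := by
  have hchart : VectorField.mlieBracket I X Y x = ((ContinuousLinearMap.id ℝ E).inverse
      (VectorField.lieBracketWithin (E := E) ℝ (fieldInChart I x X) (fieldInChart I x Y)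
        ((extChartAt I x).symm ⁻¹' Set.univ ∩ Set.range I) (extChartAt I x x)) : E) := by
    rw [← VectorField.mlieBracketWithin_univ, VectorField.mlieBracketWithin_apply,
      mfderiv_extChartAt_self]
    rfl
  rw [hchart, mvfderiv_compAlong_id hX, mvfderiv_compAlong_id hY, ContinuousLinearMap.inverse_id,
    ContinuousLinearMap.id_apply, Set.preimage_univ, Set.univ_inter, I.range_eq_univ,
    VectorField.lieBracketWithin_univ, VectorField.lieBracket_eq]
  exact congrArg₂ (fun X₀ Y₀ : E ↦ fderiv ℝ (fieldInChart I x Y) (extChartAt I x x) X₀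
    - fderiv ℝ (fieldInChart I x X) (extChartAt I x x) Y₀)
    (fieldInChart_self x X) (fieldInChart_self x Y)

theorem mdifferentiableAt_mvfderiv_apply (hh : ContMDiffAt I 𝓘(ℝ, W) 2 h x)
    (hX : MDifferentiableAt I I.tangent (fun x' ↦ (⟨x', X x'⟩ : TangentBundle I M)) x) :
    MDifferentiableAt I 𝓘(ℝ, W) (fun x' ↦ mvfderiv I h x' (X x')) x :=
  mdifferentiableAt_ambientField (f := id) hh mdifferentiableAt_id
    ((mdifferentiableAt_section I X).1 hX)

theorem mvfderiv_mvfderiv_apply (hh : ContMDiffAt I 𝓘(ℝ, W) 2 h x)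
    (hX : MDifferentiableAt I I.tangent (fun x' ↦ (⟨x', X x'⟩ : TangentBundle I M)) x)
    (u : TangentSpace I x) :
    mvfderiv I (fun x' ↦ mvfderiv I h x' (X x')) x u
      = fderiv ℝ (fderiv ℝ (inChart I h x)) (extChartAt I x x) u (X x)
        + mvfderiv I h x (mvfderiv I (compAlong I (f := id) x X) x u : E) := by
  have := mvfderiv_ambientField (f := id) hh mdifferentiableAt_id
    ((mdifferentiableAt_section I X).1 hX) u
  rwa [mfderiv_id] at this

theorem mvfderiv_mlieBracket [CompleteSpace E] (hh : ContMDiffAt I 𝓘(ℝ, W) 2 h x)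
    (hX : MDifferentiableAt I I.tangent (fun x' ↦ (⟨x', X x'⟩ : TangentBundle I M)) x)
    (hY : MDifferentiableAt I I.tangent (fun x' ↦ (⟨x', Y x'⟩ : TangentBundle I M)) x) :
    mvfderiv I h x (VectorField.mlieBracket I X Y x)
      = mvfderiv I (fun x' ↦ mvfderiv I h x' (Y x')) x (X x)
        - mvfderiv I (fun x' ↦ mvfderiv I h x' (X x')) x (Y x) := by
  have hsymm := ((contDiffAt_inChart (n := 2) x (mem_chart_source H x) hh).isSymmSndFDerivAt
    (by simp)).eq (X x) (Y x)
  rw [mvfderiv_mvfderiv_apply hh hX, mvfderiv_mvfderiv_apply hh hY, mlieBracket_eq_sub hX hY, hsymm,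
    add_sub_add_left_eq_sub]
  exact (mvfderiv I h x).map_sub _ _

end LieBracket

section CurvatureAlong

variable {E : Type*} [NormedAddCommGroup E] [NormedSpace ℝ E]
  {H : Type*} [TopologicalSpace H] {I : ModelWithCorners ℝ E H}
  {M : Type*} [TopologicalSpace M] [ChartedSpace H M]
  {F : Type*} [NormedAddCommGroup F] [NormedSpace ℝ F] [FiniteDimensional ℝ F]
  {K : Type*} [TopologicalSpace K] {J : ModelWithCorners ℝ F K} [J.Boundaryless]
  {P : Type*} [TopologicalSpace P] [ChartedSpace K P] [IsManifold J ∞ P]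
  {W : Type*} [NormedAddCommGroup W] [NormedSpace ℝ W]

omit [FiniteDimensional ℝ F] [J.Boundaryless] in
theorem contMDiffAt_extend {p : P} (u : TangentSpace J p) :
    ContMDiffAt J J.tangent ∞
      (fun q ↦ (⟨q, FiberBundle.extend F u q⟩ : TangentBundle J P)) p := by
  obtain ⟨s, hs, hu⟩ := FiberBundle.exists_contMDiffOn_extend (k := ∞) J F
    (V := TangentSpace J) u
  exact hu.contMDiffAt hs

/-- The curvature `R(a, b)v` at `w` of the connection `D + S` of the vector space `W`. -/
def connectionCurvature (S : W → W →L[ℝ] W →L[ℝ] W) (w a b v : W) : W :=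
  fderiv ℝ S w a b v - fderiv ℝ S w b a v + S w a (S w b v) - S w b (S w a v)

namespace IsAmbientModel

variable [FiniteDimensional ℝ W]
  {g : Π p : P, TangentSpace J p →L[ℝ] TangentSpace J p →L[ℝ] ℝ} {Φ : P → W}
  {G : W → W →L[ℝ] W →L[ℝ] ℝ} {θ : W → W →L[ℝ] ℝ} {S : W → W →L[ℝ] W →L[ℝ] W}
  {f : M → P} {V : Π x : M, TangentSpace J (f x)} {X Y : Π x : M, TangentSpace I x} {x : M}

theorem ambientField_covDerivAlong_eventuallyEq [IsManifold I ∞ M]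
    (h : IsAmbientModel J g Φ G θ S) (hf : ContMDiffAt I J 2 f x)
    (hV : ContMDiffAt I 𝓘(ℝ, W) 2 (ambientField J Φ V) x) (Y : Π x : M, TangentSpace I x) :
    ambientField J Φ (fun x' ↦ covDerivAlong I J g f V x' (Y x')) =ᶠ[𝓝 x]
      fun x' ↦ mvfderiv I (ambientField J Φ V) x' (Y x')
        + S (Φ (f x')) (mvfderiv I (fun z ↦ Φ (f z)) x' (Y x')) (ambientField J Φ V x') := by
  filter_upwards [(contMDiffAt_iff_contMDiffAt_nhds (by simp)).1 hf,
    (contMDiffAt_iff_contMDiffAt_nhds (by simp)).1 hV] with x' hf' hV'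
  exact h.mvfderiv_covDerivAlong (hf'.mdifferentiableAt (by simp))
    (hV'.mdifferentiableAt (by simp)) (Y x')

variable [IsManifold I ∞ M] [I.Boundaryless]

omit [FiniteDimensional ℝ F] [J.Boundaryless] [IsManifold J ∞ P] [FiniteDimensional ℝ W] in
theorem mdifferentiableAt_connection_apply_mvfderiv (h : IsAmbientModel J g Φ G θ S)
    (hf : ContMDiffAt I J 2 f x)
    (hY : MDifferentiableAt I I.tangent (fun x' ↦ (⟨x', Y x'⟩ : TangentBundle I M)) x) :
    MDifferentiableAt I 𝓘(ℝ, W →L[ℝ] W)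
      (fun x' ↦ S (Φ (f x')) (mvfderiv I (fun z ↦ Φ (f z)) x' (Y x'))) x :=
  (mdifferentiableAt_comp_vector (W' := W →L[ℝ] W →L[ℝ] W) (h := fun z ↦ Φ (f z))
    (h.differentiableAt_connection (f x))
    (((h.contMDiffAt (n := 2) _).comp x hf).mdifferentiableAt (by simp))).clm_apply
    (mdifferentiableAt_mvfderiv_apply ((h.contMDiffAt (n := 2) _).comp x hf) hY)

theorem mdifferentiableAt_ambientField_covDerivAlong (h : IsAmbientModel J g Φ G θ S)
    (hf : ContMDiffAt I J 2 f x) (hV : ContMDiffAt I 𝓘(ℝ, W) 2 (ambientField J Φ V) x)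
    (hY : MDifferentiableAt I I.tangent (fun x' ↦ (⟨x', Y x'⟩ : TangentBundle I M)) x) :
    MDifferentiableAt I 𝓘(ℝ, W)
      (ambientField J Φ (fun x' ↦ covDerivAlong I J g f V x' (Y x'))) x :=
  ((mdifferentiableAt_mvfderiv_apply hV hY).add
    ((h.mdifferentiableAt_connection_apply_mvfderiv hf hY).clm_apply
      (hV.mdifferentiableAt (by simp)))).congr_of_eventuallyEq
    (h.ambientField_covDerivAlong_eventuallyEq hf hV Y)

theorem mvfderiv_ambientField_covDerivAlong (h : IsAmbientModel J g Φ G θ S)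
    (hf : ContMDiffAt I J 2 f x) (hV : ContMDiffAt I 𝓘(ℝ, W) 2 (ambientField J Φ V) x)
    (hY : MDifferentiableAt I I.tangent (fun x' ↦ (⟨x', Y x'⟩ : TangentBundle I M)) x)
    (u : TangentSpace I x) :
    mvfderiv I (ambientField J Φ (fun x' ↦ covDerivAlong I J g f V x' (Y x'))) x u
      = mvfderiv I (fun x' ↦ mvfderiv I (ambientField J Φ V) x' (Y x')) x u
        + fderiv ℝ S (Φ (f x)) (mvfderiv I (fun z ↦ Φ (f z)) x u)
          (mvfderiv I (fun z ↦ Φ (f z)) x (Y x)) (ambientField J Φ V x)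
        + S (Φ (f x)) (mvfderiv I (fun x' ↦ mvfderiv I (fun z ↦ Φ (f z)) x' (Y x')) x u)
          (ambientField J Φ V x)
        + S (Φ (f x)) (mvfderiv I (fun z ↦ Φ (f z)) x (Y x))
          (mvfderiv I (ambientField J Φ V) x u) := by
  have hΦf : ContMDiffAt I 𝓘(ℝ, W) 2 (fun z ↦ Φ (f z)) x := (h.contMDiffAt (n := 2) _).comp x hf
  have hΦfd := hΦf.mdifferentiableAt (by simp)
  have hVd := hV.mdifferentiableAt (by simp)
  have hS := mdifferentiableAt_comp_vector (W' := W →L[ℝ] W →L[ℝ] W) (h := fun z ↦ Φ (f z))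
    (h.differentiableAt_connection (f x)) hΦfd
  have hSY := h.mdifferentiableAt_connection_apply_mvfderiv hf hY
  rw [mvfderiv_congr_of_eventuallyEq (h.ambientField_covDerivAlong_eventuallyEq hf hV Y),
    mvfderiv_fun_add (mdifferentiableAt_mvfderiv_apply hV hY) (hSY.clm_apply hVd), add_apply,
    mvfderiv_clm_apply hSY hVd,
    mvfderiv_clm_apply hS (mdifferentiableAt_mvfderiv_apply hΦf hY),
    mvfderiv_comp_vector (W' := W →L[ℝ] W →L[ℝ] W) (h := fun z ↦ Φ (f z))
      (h.differentiableAt_connection (f x)) hΦfd,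
    add_apply]
  abel

theorem mvfderiv_curvature_along [CompleteSpace E] (h : IsAmbientModel J g Φ G θ S)
    (hf : ContMDiffAt I J 2 f x) (hV : ContMDiffAt I 𝓘(ℝ, W) 2 (ambientField J Φ V) x)
    (hX : MDifferentiableAt I I.tangent (fun x' ↦ (⟨x', X x'⟩ : TangentBundle I M)) x)
    (hY : MDifferentiableAt I I.tangent (fun x' ↦ (⟨x', Y x'⟩ : TangentBundle I M)) x) :
    mvfderiv J Φ (f x)
      (covDerivAlong I J g f (fun x' ↦ covDerivAlong I J g f V x' (Y x')) x (X x)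
        - covDerivAlong I J g f (fun x' ↦ covDerivAlong I J g f V x' (X x')) x (Y x)
        - covDerivAlong I J g f V x (VectorField.mlieBracket I X Y x))
      = connectionCurvature S (Φ (f x)) (mvfderiv I (fun z ↦ Φ (f z)) x (X x))
        (mvfderiv I (fun z ↦ Φ (f z)) x (Y x)) (ambientField J Φ V x) := by
  have hfd := hf.mdifferentiableAt (by simp)
  have hΦf : ContMDiffAt I 𝓘(ℝ, W) 2 (fun z ↦ Φ (f z)) x := (h.contMDiffAt (n := 2) _).comp x hf
  rw [map_sub, map_sub,
    h.mvfderiv_covDerivAlong hfd (h.mdifferentiableAt_ambientField_covDerivAlong hf hV hY),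
    h.mvfderiv_covDerivAlong hfd (h.mdifferentiableAt_ambientField_covDerivAlong hf hV hX),
    h.mvfderiv_covDerivAlong hfd (hV.mdifferentiableAt (by simp)),
    h.mvfderiv_ambientField_covDerivAlong hf hV hX,
    h.mvfderiv_ambientField_covDerivAlong hf hV hY,
    (h.ambientField_covDerivAlong_eventuallyEq hf hV X).self_of_nhds,
    (h.ambientField_covDerivAlong_eventuallyEq hf hV Y).self_of_nhds,
    mvfderiv_mlieBracket hV hX hY, mvfderiv_mlieBracket hΦf hX hY, connectionCurvature]
  simp only [map_add, map_sub, sub_apply]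
  abel

omit [I.Boundaryless] [IsManifold I ∞ M] in
theorem mvfderiv_curvatureTensor (h : IsAmbientModel J g Φ G θ S) (p : P)
    (u v w : TangentSpace J p) :
    mvfderiv J Φ p (curvatureTensor J g p u v w)
      = connectionCurvature S (Φ p) (mvfderiv J Φ p u) (mvfderiv J Φ p v)
        (mvfderiv J Φ p w) := by
  have : CompleteSpace F := FiniteDimensional.complete ℝ F
  have hcurv := h.mvfderiv_curvature_along (f := id) contMDiffAt_id
    (contMDiffAt_ambientField (n := 2) (f := id) h.contMDiffAt
      ((contMDiffAt_extend w).of_le ENat.LEInfty.out))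
    ((contMDiffAt_extend u).mdifferentiableAt (by simp))
    ((contMDiffAt_extend v).mdifferentiableAt (by simp))
  simp only [ambientField, id] at hcurv
  rw [FiberBundle.extend_apply_self F u, FiberBundle.extend_apply_self F v,
    FiberBundle.extend_apply_self F w] at hcurv
  exact hcurv

end IsAmbientModel

end CurvatureAlong

section Immersion

variable {E : Type*} [NormedAddCommGroup E] [NormedSpace ℝ E]
  {H : Type*} [TopologicalSpace H] {I : ModelWithCorners ℝ E H}
  {M : Type*} [TopologicalSpace M] [ChartedSpace H M]
  {F : Type*} [NormedAddCommGroup F] [NormedSpace ℝ F]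
  {K : Type*} [TopologicalSpace K] {J : ModelWithCorners ℝ F K}
  {P : Type*} [TopologicalSpace P] [ChartedSpace K P]
  {gM : Π x : M, TangentSpace I x →L[ℝ] TangentSpace I x →L[ℝ] ℝ}
  {g : Π p : P, TangentSpace J p →L[ℝ] TangentSpace J p →L[ℝ] ℝ} {f : M → P} {x : M}

theorem normalPart_sub (w w' : TangentSpace J (f x)) :
    normalPart I J gM g f x (w - w')
      = normalPart I J gM g f x w - normalPart I J gM g f x w' := by
  simp only [normalPart, tangentPart, map_sub, ContinuousLinearMap.sub_comp]
  abel

theorem normalPart_neg (w : TangentSpace J (f x)) :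
    normalPart I J gM g f x (-w) = -normalPart I J gM g f x w := by
  simp only [normalPart, tangentPart, map_neg, ContinuousLinearMap.neg_comp]
  abel

variable [IsManifold I ∞ M]

theorem IsSemiRiemannianMetric.eq_of_forall_apply_eq (hgM : IsSemiRiemannianMetric I gM)
    {u v : TangentSpace I x} (huv : ∀ z, gM x u z = gM x v z) : u = v :=
  sub_eq_zero.1 (hgM.nondegenerate x _ fun z ↦ by rw [map_sub, sub_apply, huv, sub_self])

theorem apply_tangentPart [FiniteDimensional ℝ E] (hgM : IsSemiRiemannianMetric I gM)
    (w : TangentSpace J (f x)) (z : TangentSpace I x) :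
    gM x (tangentPart I J gM g f x w) z = g (f x) w (mfderiv I J f x z) := by
  have hinv : (gM x).IsInvertible :=
    isInvertible_of_forall_apply_eq_zero (F := E) (hgM.nondegenerate x)
  exact congrArg (fun L : E →L[ℝ] ℝ ↦ L z)
    (hinv.self_apply_inverse ((g (f x) w).comp (mfderiv I J f x)))

variable [FiniteDimensional ℝ E]

theorem tangentPart_mfderiv (hgM : IsSemiRiemannianMetric I gM)
    (hf : IsIsometricImmersion I J gM g f) (u : TangentSpace I x) :
    tangentPart I J gM g f x (mfderiv I J f x u) = u :=
  hgM.eq_of_forall_apply_eq fun z ↦ (apply_tangentPart hgM _ z).trans (hf.isometric x u z).symm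

theorem normalPart_mfderiv (hgM : IsSemiRiemannianMetric I gM)
    (hf : IsIsometricImmersion I J gM g f) (u : TangentSpace I x) :
    normalPart I J gM g f x (mfderiv I J f x u) = 0 := by
  rw [normalPart, tangentPart_mfderiv hgM hf, sub_self]

end Immersion

section CovDerivAlong

variable {E : Type*} [NormedAddCommGroup E] [NormedSpace ℝ E]
  {H : Type*} [TopologicalSpace H] {I : ModelWithCorners ℝ E H}
  {M : Type*} [TopologicalSpace M] [ChartedSpace H M] [IsManifold I ∞ M]
  {F : Type*} [NormedAddCommGroup F] [NormedSpace ℝ F]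
  {K : Type*} [TopologicalSpace K] {J : ModelWithCorners ℝ F K}
  {P : Type*} [TopologicalSpace P] [ChartedSpace K P] [IsManifold J ∞ P]
  {gM : Π x : M, TangentSpace I x →L[ℝ] TangentSpace I x →L[ℝ] ℝ}
  {g : Π p : P, TangentSpace J p →L[ℝ] TangentSpace J p →L[ℝ] ℝ} {f : M → P} {x : M}

theorem christoffel_neg_left {p : P} (y v w : F) :
    christoffel J g p y (-v) w = -christoffel J g p y v w := by
  rw [christoffel, christoffel, ← map_neg]
  congr 1
  ext z
  simp only [map_neg, neg_apply, sub_apply, add_apply, smul_apply, smul_eq_mul,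
    ContinuousLinearMap.flip_apply]
  ring

omit [IsManifold I ∞ M] in
theorem covDerivAlong_neg_direction (V : Π x : M, TangentSpace J (f x)) (u : TangentSpace I x) :
    covDerivAlong I J g f V x (-u) = -covDerivAlong I J g f V x u := by
  rw [covDerivAlong, covDerivAlong, map_neg, map_neg]
  exact (congrArg (_ + ·) (christoffel_neg_left _ _ _)).trans (neg_add _ _).symm

theorem secondFundamentalForm_neg_left (u v : TangentSpace I x) :
    secondFundamentalForm I J gM g f x (-u) v = -secondFundamentalForm I J gM g f x u v :=
  (congrArg _ (covDerivAlong_neg_direction _ u)).trans (normalPart_neg _)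

end CovDerivAlong

section AmbientFrame

variable {E : Type*} [NormedAddCommGroup E] [NormedSpace ℝ E]
  {H : Type*} [TopologicalSpace H] {I : ModelWithCorners ℝ E H}
  {M : Type*} [TopologicalSpace M] [ChartedSpace H M]
  {W : Type*} [NormedAddCommGroup W] [NormedSpace ℝ W] {x : M}

theorem mdifferentiableAt_of_frame_pairing [FiniteDimensional ℝ E] {A : M → E →L[ℝ] W}
    {B : M → W →L[ℝ] W →L[ℝ] ℝ} {b : M → W} {c : M → E}
    (hA : MDifferentiableAt I 𝓘(ℝ, E →L[ℝ] W) A x)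
    (hB : MDifferentiableAt I 𝓘(ℝ, W →L[ℝ] W →L[ℝ] ℝ) B x)
    (hb : MDifferentiableAt I 𝓘(ℝ, W) b x)
    (hnondeg : ∀ u, (∀ v, B x (A x u) (A x v) = 0) → u = 0)
    (hc : ∀ᶠ x' in 𝓝 x, ∀ v, B x' (A x' (c x')) (A x' v) = B x' (b x') (A x' v)) :
    MDifferentiableAt I 𝓘(ℝ, E) c x := by
  have hpre : MDifferentiableAt I 𝓘(ℝ, (W →L[ℝ] ℝ) →L[ℝ] E →L[ℝ] ℝ)
      (fun x' ↦ (A x').precomp ℝ) x :=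
    mdifferentiableAt_comp_vector
      (Ψ := fun L : E →L[ℝ] W ↦ (L.precomp ℝ : (W →L[ℝ] ℝ) →L[ℝ] E →L[ℝ] ℝ))
      (ContinuousLinearMap.compL ℝ E W ℝ).flip.differentiableAt hA
  exact mdifferentiableAt_of_clm_apply_eq (hpre.clm_comp (hB.clm_comp hA))
    (fun u hu ↦ hnondeg u fun v ↦ congrArg (fun L : E →L[ℝ] ℝ ↦ L v) hu)
    ((hB.clm_apply hb).clm_comp hA) (hc.mono fun x' hx' ↦ ContinuousLinearMap.ext hx')

end AmbientFrame

section Ricci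

variable {E : Type*} [NormedAddCommGroup E] [NormedSpace ℝ E]
  {H : Type*} [TopologicalSpace H] {I : ModelWithCorners ℝ E H}
  {M : Type*} [TopologicalSpace M] [ChartedSpace H M]
  {F : Type*} [NormedAddCommGroup F] [NormedSpace ℝ F]
  {K : Type*} [TopologicalSpace K] {J : ModelWithCorners ℝ F K}
  {P : Type*} [TopologicalSpace P] [ChartedSpace K P]
  {W : Type*} [NormedAddCommGroup W] [NormedSpace ℝ W]
  {gM : Π x : M, TangentSpace I x →L[ℝ] TangentSpace I x →L[ℝ] ℝ}
  {g : Π p : P, TangentSpace J p →L[ℝ] TangentSpace J p →L[ℝ] ℝ} {Φ : P → W}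
  {G : W → W →L[ℝ] W →L[ℝ] ℝ} {θ : W → W →L[ℝ] ℝ} {S : W → W →L[ℝ] W →L[ℝ] W}
  {f : M → P} {V V' : Π x : M, TangentSpace J (f x)} {T T' : Π x : M, TangentSpace I x} {x : M}

omit [TopologicalSpace M] in
theorem ambientField_sub :
    ambientField J Φ (fun x' ↦ V x' - V' x') = ambientField J Φ V - ambientField J Φ V' :=
  funext fun _ ↦ map_sub _ _ _

namespace IsAmbientModel

theorem eq_of_mvfderiv_eq (h : IsAmbientModel J g Φ G θ S) {p : P} {u v : TangentSpace J p}
    (huv : mvfderiv J Φ p u = mvfderiv J Φ p v) : u = v :=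
  sub_eq_zero.1 (h.injective p _ (by rw [map_sub, huv, sub_self]))

theorem apply_comm (h : IsAmbientModel J g Φ G θ S) (p : P) (u v : TangentSpace J p) :
    g p u v = g p v u := by
  rw [h.metric_eq, h.metric_eq, h.metric_symm]

theorem ambientField_mfderiv (h : IsAmbientModel J g Φ G θ S) (hf : MDifferentiable I J f) :
    ambientField J Φ (fun x' ↦ mfderiv I J f x' (T x'))
      = fun x' ↦ mvfderiv I (fun z ↦ Φ (f z)) x' (T x') :=
  funext fun x' ↦ h.mvfderiv_mfderiv (hf x') (T x')

theorem contMDiffAt_comp (h : IsAmbientModel J g Φ G θ S) {n : ℕ} (hf : ContMDiff I J ∞ f) :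
    ContMDiffAt I 𝓘(ℝ, W) n (fun z ↦ Φ (f z)) x :=
  (h.contMDiffAt _).comp x ((hf x).of_le (mod_cast le_top))

theorem isometric_ambient (h : IsAmbientModel J g Φ G θ S)
    (hf : IsIsometricImmersion I J gM g f) (u v : TangentSpace I x) :
    gM x u v = G (Φ (f x)) (mvfderiv I (fun z ↦ Φ (f z)) x u)
      (mvfderiv I (fun z ↦ Φ (f z)) x v) := by
  have hfd := hf.contMDiff.mdifferentiable (by simp) x
  rw [hf.isometric, h.metric_eq, h.mvfderiv_mfderiv hfd, h.mvfderiv_mfderiv hfd]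

section LeviCivita

variable [FiniteDimensional ℝ F] [J.Boundaryless] [IsManifold J ∞ P] [FiniteDimensional ℝ W]

theorem covDerivAlong_sub (h : IsAmbientModel J g Φ G θ S) (hf : MDifferentiableAt I J f x)
    (hV : MDifferentiableAt I 𝓘(ℝ, W) (ambientField J Φ V) x)
    (hV' : MDifferentiableAt I 𝓘(ℝ, W) (ambientField J Φ V') x) (u : TangentSpace I x) :
    covDerivAlong I J g f (fun x' ↦ V x' - V' x') x u
      = covDerivAlong I J g f V x u - covDerivAlong I J g f V' x u := by
  have hsub : MDifferentiableAt I 𝓘(ℝ, W) (ambientField J Φ fun x' ↦ V x' - V' x') x := by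
    rw [ambientField_sub]
    exact hV.sub hV'
  refine h.eq_of_mvfderiv_eq ?_
  rw [map_sub, h.mvfderiv_covDerivAlong hf hsub, h.mvfderiv_covDerivAlong hf hV,
    h.mvfderiv_covDerivAlong hf hV', ambientField_sub, mvfderiv_sub hV hV']
  simp only [Pi.sub_apply, map_sub, sub_apply]
  abel

theorem mvfderiv_metric (h : IsAmbientModel J g Φ G θ S) (hf : MDifferentiableAt I J f x)
    (hV : MDifferentiableAt I 𝓘(ℝ, W) (ambientField J Φ V) x)
    (hV' : MDifferentiableAt I 𝓘(ℝ, W) (ambientField J Φ V') x) (u : TangentSpace I x) :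
    mvfderiv I (fun x' ↦ g (f x') (V x') (V' x')) x u
      = g (f x) (covDerivAlong I J g f V x u) (V' x)
        + g (f x) (V x) (covDerivAlong I J g f V' x u) := by
  have hΦf : MDifferentiableAt I 𝓘(ℝ, W) (fun z ↦ Φ (f z)) x :=
    ((h.contMDiffAt (n := 1) (f x)).mdifferentiableAt (by simp)).comp x hf
  have hG := mdifferentiableAt_comp_vector (W' := W →L[ℝ] W →L[ℝ] ℝ) (h := fun z ↦ Φ (f z))
    (h.differentiableAt_metric (f x)) hΦf
  have hambient : (fun x' ↦ g (f x') (V x') (V' x'))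
      = fun x' ↦ G (Φ (f x')) (ambientField J Φ V x') (ambientField J Φ V' x') :=
    funext fun _ ↦ h.metric_eq _ _ _
  have htangent : θ (Φ (f x)) (mvfderiv I (fun z ↦ Φ (f z)) x u) = 0 := by
    rw [← h.mvfderiv_mfderiv hf]
    exact h.form_tangent _ _
  rw [hambient, mvfderiv_clm_apply (hG.clm_apply hV) hV', mvfderiv_clm_apply hG hV,
    mvfderiv_comp_vector (W' := W →L[ℝ] W →L[ℝ] ℝ) (h := fun z ↦ Φ (f z))
      (h.differentiableAt_metric (f x)) hΦf, add_apply,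
    h.metric_eq, h.metric_eq, h.mvfderiv_covDerivAlong hf hV, h.mvfderiv_covDerivAlong hf hV',
    h.metric_compatible (f x) _ (ambientField J Φ V x) (ambientField J Φ V' x) htangent
      (h.form_tangent (f x) (V x)) (h.form_tangent (f x) (V' x))]
  simp only [map_add, add_apply, ambientField]
  ring

end LeviCivita

variable [IsManifold I ∞ M] [I.Boundaryless]

theorem mdifferentiableAt_ambientField_mfderiv (h : IsAmbientModel J g Φ G θ S)
    (hf : ContMDiff I J ∞ f)
    (hT : MDifferentiableAt I I.tangent (fun x' ↦ (⟨x', T x'⟩ : TangentBundle I M)) x) :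
    MDifferentiableAt I 𝓘(ℝ, W) (ambientField J Φ fun x' ↦ mfderiv I J f x' (T x')) x := by
  rw [h.ambientField_mfderiv (hf.mdifferentiable (by simp))]
  exact mdifferentiableAt_mvfderiv_apply (h.contMDiffAt_comp hf) hT

section SecondFundamentalForm

variable [FiniteDimensional ℝ E] [FiniteDimensional ℝ F] [J.Boundaryless] [IsManifold J ∞ P]
  [FiniteDimensional ℝ W]

omit [FiniteDimensional ℝ E] in
theorem exists_mvfderiv_covDerivAlong_mfderiv (h : IsAmbientModel J g Φ G θ S)
    (hf : ContMDiff I J ∞ f)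
    (hT : MDifferentiableAt I I.tangent (fun x' ↦ (⟨x', T x'⟩ : TangentBundle I M)) x)
    (u : TangentSpace I x) :
    ∃ z : TangentSpace I x,
      mvfderiv J Φ (f x) (covDerivAlong I J g f (fun x' ↦ mfderiv I J f x' (T x')) x u)
        = ambientHessian I (fun z ↦ Φ (f z)) S x u (T x)
          + mvfderiv I (fun z ↦ Φ (f z)) x z := by
  have hfd := hf.mdifferentiable (by simp)
  refine ⟨(mvfderiv I (compAlong I (f := id) x T) x u : E), ?_⟩
  rw [h.mvfderiv_covDerivAlong (hfd x) (h.mdifferentiableAt_ambientField_mfderiv hf hT),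
    h.ambientField_mfderiv hfd, mvfderiv_mvfderiv_apply (h.contMDiffAt_comp hf) hT,
    ambientHessian]
  exact add_right_comm _ _ _

/-- The tangential terms of `∇_u df(T)`, which depend on the derivatives of `T`, do not contribute
to its normal part. -/
theorem normalPart_covDerivAlong_mfderiv_congr (h : IsAmbientModel J g Φ G θ S)
    (hgM : IsSemiRiemannianMetric I gM) (hf : IsIsometricImmersion I J gM g f)
    (hT : MDifferentiableAt I I.tangent (fun x' ↦ (⟨x', T x'⟩ : TangentBundle I M)) x)
    (hT' : MDifferentiableAt I I.tangent (fun x' ↦ (⟨x', T' x'⟩ : TangentBundle I M)) x)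
    {u u' : TangentSpace I x}
    (hHess : ambientHessian I (fun z ↦ Φ (f z)) S x u (T x)
      = ambientHessian I (fun z ↦ Φ (f z)) S x u' (T' x)) :
    normalPart I J gM g f x (covDerivAlong I J g f (fun x' ↦ mfderiv I J f x' (T x')) x u)
      = normalPart I J gM g f x
        (covDerivAlong I J g f (fun x' ↦ mfderiv I J f x' (T' x')) x u') := by
  obtain ⟨z, hz⟩ := h.exists_mvfderiv_covDerivAlong_mfderiv hf.contMDiff hT u
  obtain ⟨z', hz'⟩ := h.exists_mvfderiv_covDerivAlong_mfderiv hf.contMDiff hT' u'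
  have htangent : covDerivAlong I J g f (fun x' ↦ mfderiv I J f x' (T x')) x u
      - covDerivAlong I J g f (fun x' ↦ mfderiv I J f x' (T' x')) x u'
      = mfderiv I J f x (z - z') := by
    refine h.eq_of_mvfderiv_eq ?_
    rw [map_sub, hz, hz', hHess, add_sub_add_left_eq_sub,
      h.mvfderiv_mfderiv (hf.contMDiff.mdifferentiable (by simp) x), map_sub]
  rw [← sub_eq_zero, ← normalPart_sub, htangent, normalPart_mfderiv hgM hf]

theorem normalPart_covDerivAlong_mfderiv (h : IsAmbientModel J g Φ G θ S)
    (hgM : IsSemiRiemannianMetric I gM) (hf : IsIsometricImmersion I J gM g f)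
    (hT : MDifferentiableAt I I.tangent (fun x' ↦ (⟨x', T x'⟩ : TangentBundle I M)) x)
    (u : TangentSpace I x) :
    normalPart I J gM g f x (covDerivAlong I J g f (fun x' ↦ mfderiv I J f x' (T x')) x u)
      = secondFundamentalForm I J gM g f x u (T x) :=
  h.normalPart_covDerivAlong_mfderiv_congr hgM hf hT
    ((contMDiffAt_extend (T x)).mdifferentiableAt (by simp))
    (by rw [FiberBundle.extend_apply_self])

theorem secondFundamentalForm_symm (h : IsAmbientModel J g Φ G θ S)
    (hgM : IsSemiRiemannianMetric I gM) (hf : IsIsometricImmersion I J gM g f)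
    (u v : TangentSpace I x) :
    secondFundamentalForm I J gM g f x u v = secondFundamentalForm I J gM g f x v u :=
  h.normalPart_covDerivAlong_mfderiv_congr hgM hf
    ((contMDiffAt_extend v).mdifferentiableAt (by simp))
    ((contMDiffAt_extend u).mdifferentiableAt (by simp))
    (by rw [FiberBundle.extend_apply_self, FiberBundle.extend_apply_self,
      ambientHessian_symm (h.contMDiffAt_comp hf.contMDiff) h.connection_symm])

omit [FiniteDimensional ℝ E] in
theorem apply_secondFundamentalForm (h : IsAmbientModel J g Φ G θ S)
    (hf : IsIsometricImmersion I J gM g f)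
    (hV : MDifferentiableAt I 𝓘(ℝ, W) (ambientField J Φ V) x)
    (hVn : ∀ᶠ x' in 𝓝 x, IsNormalTo I J g f x' (V x')) (u v : TangentSpace I x) :
    g (f x) (secondFundamentalForm I J gM g f x u v) (V x)
      = -g (f x) (covDerivAlong I J g f V x u) (mfderiv I J f x v) := by
  set T : Π x' : M, TangentSpace I x' := FiberBundle.extend E v with hT
  have hTx : T x = v := FiberBundle.extend_apply_self E v
  have hcompat := h.mvfderiv_metric (hf.contMDiff.mdifferentiable (by simp) x)
    (h.mdifferentiableAt_ambientField_mfderiv hf.contMDiff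
      ((contMDiffAt_extend v).mdifferentiableAt (by simp))) hV u
  have horthogonal : (fun x' ↦ g (f x') (mfderiv I J f x' (T x')) (V x')) =ᶠ[𝓝 x] fun _ ↦ 0 :=
    hVn.mono fun x' hx' ↦ (h.apply_comm _ _ _).trans (hx' _)
  have hnormal : g (f x) (secondFundamentalForm I J gM g f x u v) (V x)
      = g (f x) (covDerivAlong I J g f (fun x' ↦ mfderiv I J f x' (T x')) x u) (V x) := by
    rw [secondFundamentalForm, normalPart, map_sub, sub_apply,
      h.apply_comm _ (mfderiv I J f x _), hVn.self_of_nhds, sub_zero]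
  rw [mvfderiv_congr_of_eventuallyEq horthogonal, mvfderiv_const, zero_apply, ← hT, hTx] at hcompat
  rw [hnormal, h.apply_comm _ (covDerivAlong I J g f V x u)]
  exact eq_neg_of_add_eq_zero_left hcompat.symm

theorem shapeOperator_eq (h : IsAmbientModel J g Φ G θ S)
    (hgM : IsSemiRiemannianMetric I gM) (hf : IsIsometricImmersion I J gM g f)
    (hV : MDifferentiableAt I 𝓘(ℝ, W) (ambientField J Φ V) x)
    (hVn : ∀ᶠ x' in 𝓝 x, IsNormalTo I J g f x' (V x')) (u : TangentSpace I x) :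
    shapeOperator I J gM g f x (V x) u
      = -tangentPart I J gM g f x (covDerivAlong I J g f V x u) := by
  have hdual (v : TangentSpace I x) :
      gM x (-tangentPart I J gM g f x (covDerivAlong I J g f V x u)) v
        = g (f x) (secondFundamentalForm I J gM g f x u v) (V x) := by
    rw [h.apply_secondFundamentalForm hf hV hVn, map_neg, neg_apply, apply_tangentPart hgM]
  have hexists : ∃ a, ∀ v, gM x a v
      = g (f x) (secondFundamentalForm I J gM g f x u v) (V x) := ⟨_, hdual⟩
  rw [shapeOperator, dif_pos hexists]
  exact hgM.eq_of_forall_apply_eq fun z ↦ (hexists.choose_spec z).trans (hdual z).symm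

end SecondFundamentalForm

variable [FiniteDimensional ℝ E]

theorem mdifferentiableAt_tangentPart (h : IsAmbientModel J g Φ G θ S)
    (hgM : IsSemiRiemannianMetric I gM) (hf : IsIsometricImmersion I J gM g f)
    (hV : MDifferentiableAt I 𝓘(ℝ, W) (ambientField J Φ V) x) :
    MDifferentiableAt I I.tangent
      (fun x' ↦ (⟨x', tangentPart I J gM g f x' (V x')⟩ : TangentBundle I M)) x := by
  have hΦf (x' : M) : ContMDiffAt I 𝓘(ℝ, W) 1 (fun z ↦ Φ (f z)) x' :=
    h.contMDiffAt_comp (n := 1) hf.contMDiff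
  have hB := mdifferentiableAt_comp_vector (W' := W →L[ℝ] W →L[ℝ] ℝ) (h := fun z ↦ Φ (f z))
    (h.differentiableAt_metric (f x)) ((hΦf x).mdifferentiableAt (by simp))
  refine (mdifferentiableAt_section I _).2 (mdifferentiableAt_of_frame_pairing
    (mdifferentiableAt_fderiv_inChart_comp (f := id) (h.contMDiffAt_comp hf.contMDiff)
      mdifferentiableAt_id) hB hV
    (fun (u : TangentSpace I x) hu ↦ hgM.nondegenerate x u fun v ↦ ?_) ?_)
  · rw [h.isometric_ambient hf, mvfderiv_eq_fderiv_inChart_self (hΦf x),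
      mvfderiv_eq_fderiv_inChart_self (hΦf x)]
    exact hu v
  filter_upwards [(chartAt H x).open_source.mem_nhds (mem_chart_source H x)] with x' hx' v
  obtain ⟨v', hv'⟩ : ∃ v' : TangentSpace I x',
      (trivializationAt E (TangentSpace I) x (⟨x', v'⟩ : TangentBundle I M)).2 = v :=
    ⟨(trivializationAt E (TangentSpace I) x).symm x' v, congrArg Prod.snd
      (Trivialization.apply_mk_symm (trivializationAt E (TangentSpace I) x) (by exact hx') v)⟩
  have hdual := h.isometric_ambient hf (tangentPart I J gM g f x' (V x')) v'
  rw [apply_tangentPart hgM, h.metric_eq,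
    h.mvfderiv_mfderiv (hf.contMDiff.mdifferentiable (by simp) x'),
    mvfderiv_eq_fderiv_inChart x hx' (hΦf x'), mvfderiv_eq_fderiv_inChart x hx' (hΦf x'),
    hv'] at hdual
  exact hdual.symm

variable [FiniteDimensional ℝ F] [J.Boundaryless] [IsManifold J ∞ P] [FiniteDimensional ℝ W]
  {X Y Z : Π x : M, TangentSpace I x}

theorem normalConnection_normalConnection (h : IsAmbientModel J g Φ G θ S)
    (hgM : IsSemiRiemannianMetric I gM) (hf : IsIsometricImmersion I J gM g f)
    (hV : ContMDiffAt I 𝓘(ℝ, W) 2 (ambientField J Φ V) x)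
    (hVn : ∀ᶠ x' in 𝓝 x, IsNormalTo I J g f x' (V x'))
    (hZ : MDifferentiableAt I I.tangent (fun x' ↦ (⟨x', Z x'⟩ : TangentBundle I M)) x)
    (u : TangentSpace I x) :
    normalConnection I J gM g f (fun x' ↦ normalConnection I J gM g f V x' (Z x')) x u
      = normalPart I J gM g f x
          (covDerivAlong I J g f (fun x' ↦ covDerivAlong I J g f V x' (Z x')) x u)
        + secondFundamentalForm I J gM g f x (shapeOperator I J gM g f x (V x) (Z x)) u := by
  have hcov := h.mdifferentiableAt_ambientField_covDerivAlong
    ((hf.contMDiff x).of_le ENat.LEInfty.out) hV hZ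
  have htangent := h.mdifferentiableAt_tangentPart hgM hf hcov
  have hsub := h.covDerivAlong_sub (hf.contMDiff.mdifferentiable (by simp) x) hcov
    (h.mdifferentiableAt_ambientField_mfderiv hf.contMDiff htangent) u
  rw [h.shapeOperator_eq hgM hf (hV.mdifferentiableAt (by simp)) hVn,
    secondFundamentalForm_neg_left, h.secondFundamentalForm_symm hgM hf _ u,
    ← h.normalPart_covDerivAlong_mfderiv hgM hf htangent u, ← sub_eq_add_neg, ← normalPart_sub,
    ← hsub]
  rfl

theorem curvature_along_eq_curvatureTensor (h : IsAmbientModel J g Φ G θ S)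
    (hf : ContMDiffAt I J 2 f x) (hV : ContMDiffAt I 𝓘(ℝ, W) 2 (ambientField J Φ V) x)
    (hX : MDifferentiableAt I I.tangent (fun x' ↦ (⟨x', X x'⟩ : TangentBundle I M)) x)
    (hY : MDifferentiableAt I I.tangent (fun x' ↦ (⟨x', Y x'⟩ : TangentBundle I M)) x) :
    covDerivAlong I J g f (fun x' ↦ covDerivAlong I J g f V x' (Y x')) x (X x)
        - covDerivAlong I J g f (fun x' ↦ covDerivAlong I J g f V x' (X x')) x (Y x)
        - covDerivAlong I J g f V x (VectorField.mlieBracket I X Y x)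
      = curvatureTensor J g (f x) (mfderiv I J f x (X x)) (mfderiv I J f x (Y x)) (V x) := by
  have := FiniteDimensional.complete ℝ E
  refine h.eq_of_mvfderiv_eq ((h.mvfderiv_curvature_along hf hV hX hY).trans ?_)
  rw [h.mvfderiv_curvatureTensor, h.mvfderiv_mfderiv (hf.mdifferentiableAt (by simp)),
    h.mvfderiv_mfderiv (hf.mdifferentiableAt (by simp))]
  rfl

theorem ricci_equation (h : IsAmbientModel J g Φ G θ S)
    (hgM : IsSemiRiemannianMetric I gM) (hf : IsIsometricImmersion I J gM g f)
    (hV : ContMDiffAt I 𝓘(ℝ, W) 2 (ambientField J Φ V) x)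
    (hVn : ∀ᶠ x' in 𝓝 x, IsNormalTo I J g f x' (V x'))
    (hX : MDifferentiableAt I I.tangent (fun x' ↦ (⟨x', X x'⟩ : TangentBundle I M)) x)
    (hY : MDifferentiableAt I I.tangent (fun x' ↦ (⟨x', Y x'⟩ : TangentBundle I M)) x) :
    normalCurvature I J gM g f X Y V x
      = normalPart I J gM g f x
          (curvatureTensor J g (f x) (mfderiv I J f x (X x)) (mfderiv I J f x (Y x)) (V x))
        + (secondFundamentalForm I J gM g f x (shapeOperator I J gM g f x (V x) (Y x)) (X x)
          - secondFundamentalForm I J gM g f x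
            (shapeOperator I J gM g f x (V x) (X x)) (Y x)) := by
  rw [normalCurvature, h.normalConnection_normalConnection hgM hf hV hVn hX,
    h.normalConnection_normalConnection hgM hf hV hVn hY,
    ← h.curvature_along_eq_curvatureTensor ((hf.contMDiff x).of_le ENat.LEInfty.out) hV hX hY,
    normalPart_sub, normalPart_sub, normalConnection]
  abel

end IsAmbientModel

end Ricci

section WarpedForms

open ContinuousLinearMap

/-- The bilinear map `(z, z') ↦ C(z, z') w`, as a linear function of `w`. -/
def smulBilin {W : Type*} [NormedAddCommGroup W] [NormedSpace ℝ W] (C : W →L[ℝ] W →L[ℝ] ℝ) :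
    W →L[ℝ] W →L[ℝ] W →L[ℝ] W :=
  ((compL ℝ W (W →L[ℝ] ℝ) (W →L[ℝ] W)).flip C).comp ((compL ℝ W ℝ W).comp (lsmul ℝ ℝ).flip)

theorem smulBilin_apply {W : Type*} [NormedAddCommGroup W] [NormedSpace ℝ W]
    (C : W →L[ℝ] W →L[ℝ] ℝ) (w z z' : W) : smulBilin C w z z' = C z z' • w := rfl

variable {V : Type*} [NormedAddCommGroup V] [NormedSpace ℝ V]

variable (V) in
/-- The symmetric bilinear map `((τ, v), (τ', v')) ↦ (0, τ v' + τ' v)` on `ℝ × V`, the part of the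
Christoffel symbols of a warped product that mixes the two factors. -/
def mixedProduct : ℝ × V →L[ℝ] ℝ × V →L[ℝ] ℝ × V :=
  (compL ℝ (ℝ × V) V (ℝ × V) (inr ℝ ℝ V)).comp
    ((lsmul ℝ ℝ).bilinearComp (fst ℝ ℝ V) (snd ℝ ℝ V)
      + ((lsmul ℝ ℝ).bilinearComp (fst ℝ ℝ V) (snd ℝ ℝ V)).flip)

theorem mixedProduct_apply (z z' : ℝ × V) :
    mixedProduct V z z' = (0, z.1 • z'.2 + z'.1 • z.2) := by
  simp [mixedProduct]

/-- The warped bilinear form `ε dt² + a(t)² B` on `ℝ × V`. -/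
def warpedForm (ε : ℝ) (a : ℝ → ℝ) (B : V →L[ℝ] V →L[ℝ] ℝ) (w : ℝ × V) :
    ℝ × V →L[ℝ] ℝ × V →L[ℝ] ℝ :=
  ε • (ContinuousLinearMap.mul ℝ ℝ).bilinearComp (fst ℝ ℝ V) (fst ℝ ℝ V)
    + a w.1 ^ 2 • B.bilinearComp (snd ℝ ℝ V) (snd ℝ ℝ V)

/-- The `1`-form `(τ, v) ↦ B(ξ, v)` at `(t, ξ)`: half the differential of `B(ξ, ξ)`, so that its
kernel is tangent to the products of `ℝ` with the quadrics of `B`. -/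
def quadricForm (B : V →L[ℝ] V →L[ℝ] ℝ) (w : ℝ × V) : ℝ × V →L[ℝ] ℝ :=
  (B w.2).comp (snd ℝ ℝ V)

/-- The symbols at `(t, ξ)` of a connection on `ℝ × V` which, along `B(ξ, ξ) = c`, restricts to the
Levi-Civita connection of `ε dt² + a(t)² B`. The term `c B(v, v') ξ` is the second fundamental form
of the quadric, with the sign that cancels the component of `D` transverse to it. -/
def warpedChristoffel (ε c : ℝ) (a : ℝ → ℝ) (B : V →L[ℝ] V →L[ℝ] ℝ) (w : ℝ × V) :
    ℝ × V →L[ℝ] ℝ × V →L[ℝ] ℝ × V :=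
  smulBilin (B.bilinearComp (snd ℝ ℝ V) (snd ℝ ℝ V))
      (-(ε * (a w.1 * deriv a w.1)), c • w.2)
    + (deriv a w.1 / a w.1) • mixedProduct V

variable {ε c : ℝ} {a : ℝ → ℝ} {B : V →L[ℝ] V →L[ℝ] ℝ} {w : ℝ × V}

theorem warpedForm_apply (z z' : ℝ × V) :
    warpedForm ε a B w z z' = ε * (z.1 * z'.1) + a w.1 ^ 2 * B z.2 z'.2 := by
  simp [warpedForm]

theorem quadricForm_apply (z : ℝ × V) : quadricForm B w z = B w.2 z.2 := rfl

theorem warpedChristoffel_apply (z z' : ℝ × V) :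
    warpedChristoffel ε c a B w z z'
      = (B z.2 z'.2 * -(ε * (a w.1 * deriv a w.1)),
        B z.2 z'.2 • c • w.2 + (deriv a w.1 / a w.1) • (z.1 • z'.2 + z'.1 • z.2)) := by
  simp [warpedChristoffel, smulBilin_apply, mixedProduct_apply]

theorem hasFDerivAt_comp_fst_smul {Y : Type*} [NormedAddCommGroup Y] [NormedSpace ℝ Y]
    {r : ℝ → ℝ} {r' : ℝ} (hr : HasDerivAt r r' w.1) (y : Y) :
    HasFDerivAt (fun w : ℝ × V ↦ r w.1 • y) ((r' • fst ℝ ℝ V).smulRight y) w :=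
  (hr.comp_hasFDerivAt w hasFDerivAt_fst).smul_const y

theorem hasFDerivAt_warpedForm {a' : ℝ} (ha : HasDerivAt a a' w.1) :
    HasFDerivAt (warpedForm ε a B)
      (((2 * a w.1 * a') • fst ℝ ℝ V).smulRight (B.bilinearComp (snd ℝ ℝ V) (snd ℝ ℝ V))) w := by
  have hr : HasDerivAt (fun t ↦ a t ^ 2) (2 * a w.1 * a') w.1 := (ha.pow 2).congr_deriv (by simp)
  exact (hasFDerivAt_comp_fst_smul hr (B.bilinearComp (snd ℝ ℝ V) (snd ℝ ℝ V))).const_add _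

theorem fderiv_warpedForm {a' : ℝ} (ha : HasDerivAt a a' w.1) (u z z' : ℝ × V) :
    fderiv ℝ (warpedForm ε a B) w u z z' = 2 * a w.1 * a' * u.1 * B z.2 z'.2 := by
  rw [(hasFDerivAt_warpedForm ha).fderiv]
  rfl

theorem hasFDerivAt_quadricForm :
    HasFDerivAt (quadricForm B)
      (((compL ℝ (ℝ × V) V ℝ).flip (snd ℝ ℝ V)).comp (B.comp (snd ℝ ℝ V))) w :=
  (((compL ℝ (ℝ × V) V ℝ).flip (snd ℝ ℝ V)).comp (B.comp (snd ℝ ℝ V))).hasFDerivAt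

theorem fderiv_quadricForm (u z : ℝ × V) : fderiv ℝ (quadricForm B) w u z = B u.2 z.2 := by
  rw [(hasFDerivAt_quadricForm (B := B) (w := w)).fderiv]
  rfl

theorem hasFDerivAt_warpedChristoffel {a'' : ℝ} (ha : DifferentiableAt ℝ a w.1)
    (ha' : HasDerivAt (deriv a) a'' w.1) (h0 : a w.1 ≠ 0) :
    HasFDerivAt (warpedChristoffel ε c a B)
      ((smulBilin (B.bilinearComp (snd ℝ ℝ V) (snd ℝ ℝ V))).comp
          ((-(ε * (deriv a w.1 * deriv a w.1 + a w.1 * a'')) • fst ℝ ℝ V).prod (c • snd ℝ ℝ V))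
        + (((a'' * a w.1 - deriv a w.1 * deriv a w.1) / a w.1 ^ 2) • fst ℝ ℝ V).smulRight
          (mixedProduct V)) w := by
  have hfst := ((ha.hasDerivAt.mul ha').const_mul ε).neg.comp_hasFDerivAt w
    (hasFDerivAt_fst (𝕜 := ℝ) (E := ℝ) (F := V))
  have hsnd := (hasFDerivAt_snd (𝕜 := ℝ) (E := ℝ) (F := V) (p := w)).const_smul c
  exact ((smulBilin (B.bilinearComp (snd ℝ ℝ V) (snd ℝ ℝ V))).hasFDerivAt.comp w
    (hfst.prodMk hsnd)).add (hasFDerivAt_comp_fst_smul (ha'.div ha.hasDerivAt h0) (mixedProduct V))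

theorem fderiv_warpedChristoffel {a'' : ℝ} (ha : DifferentiableAt ℝ a w.1)
    (ha' : HasDerivAt (deriv a) a'' w.1) (h0 : a w.1 ≠ 0) (u z z' : ℝ × V) :
    fderiv ℝ (warpedChristoffel ε c a B) w u z z'
      = (B z.2 z'.2 * (-(ε * (deriv a w.1 * deriv a w.1 + a w.1 * a'')) * u.1),
        B z.2 z'.2 • c • u.2 + ((a'' * a w.1 - deriv a w.1 * deriv a w.1) / a w.1 ^ 2 * u.1)
          • (z.1 • z'.2 + z'.1 • z.2)) := by
  rw [(hasFDerivAt_warpedChristoffel ha ha' h0).fderiv]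
  simp [smulBilin_apply, mixedProduct_apply]

theorem eq_zero_of_forall_warpedForm_eq_zero (hε : ε ≠ 0) (hc : c * c = 1) (h0 : a w.1 ≠ 0)
    (hB : ∀ v v', B v v' = B v' v) (hB' : ∀ v, (∀ v', B v v' = 0) → v = 0)
    (hw : B w.2 w.2 = c) {y : ℝ × V} (hy : quadricForm B w y = 0)
    (horth : ∀ z, quadricForm B w z = 0 → warpedForm ε a B w y z = 0) : y = 0 := by
  refine Prod.ext ?_ (hB' _ fun v ↦ ?_)
  · simpa [warpedForm_apply, hε] using horth (1, 0) (by simp [quadricForm_apply])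
  · have hyw : B y.2 w.2 = 0 := (hB _ _).trans hy
    have hproj := horth (0, v - (c * B w.2 v) • w.2) <| by
      simp only [quadricForm_apply, map_sub, map_smul, smul_eq_mul, hw]
      linear_combination (-B w.2 v) * hc
    simpa [warpedForm_apply, hyw, h0] using hproj

theorem warpedChristoffel_metric_compatible (hε : ε * ε = 1) (ha : DifferentiableAt ℝ a w.1)
    (h0 : a w.1 ≠ 0) (hB : ∀ v v', B v v' = B v' v) {z₁ z₂ z₃ : ℝ × V}
    (h₂ : quadricForm B w z₂ = 0) (h₃ : quadricForm B w z₃ = 0) :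
    fderiv ℝ (warpedForm ε a B) w z₁ z₂ z₃
      = warpedForm ε a B w (warpedChristoffel ε c a B w z₁ z₂) z₃
        + warpedForm ε a B w z₂ (warpedChristoffel ε c a B w z₁ z₃) := by
  rw [quadricForm_apply] at h₂ h₃
  rw [fderiv_warpedForm ha.hasDerivAt]
  simp only [warpedForm_apply, warpedChristoffel_apply, map_add, map_smul, add_apply, smul_apply,
    smul_eq_mul, h₃, hB z₂.2 w.2, h₂, hB z₂.2 z₁.2]
  field_simp
  linear_combination (deriv a w.1 * (B z₁.2 z₂.2 * z₃.1 + z₂.1 * B z₁.2 z₃.2)) * hε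

theorem warpedChristoffel_tangent_compatible (hc : c * c = 1) (hw : B w.2 w.2 = c)
    {z₁ z₂ : ℝ × V} (h₁ : quadricForm B w z₁ = 0) (h₂ : quadricForm B w z₂ = 0) :
    quadricForm B w (warpedChristoffel ε c a B w z₁ z₂) = fderiv ℝ (quadricForm B) w z₁ z₂ := by
  rw [quadricForm_apply] at h₁ h₂
  rw [fderiv_quadricForm, quadricForm_apply, warpedChristoffel_apply]
  simp only [map_add, map_smul, smul_eq_mul, h₁, h₂, hw]
  linear_combination B z₁.2 z₂.2 * hc

theorem connectionCurvature_warpedChristoffel {a'' : ℝ}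
    (hB : ∀ v v', B v v' = B v' v) (ha : DifferentiableAt ℝ a w.1)
    (ha' : HasDerivAt (deriv a) a'' w.1) (h0 : a w.1 ≠ 0) {u v z : ℝ × V}
    (hu : quadricForm B w u = 0) (hv : quadricForm B w v = 0)
    (hzu : warpedForm ε a B w z u = 0) (hzv : warpedForm ε a B w z v = 0) :
    connectionCurvature (warpedChristoffel ε c a B) w u v z
      = ((a'' * a w.1 + ε * (c - ε * deriv a w.1 ^ 2)) / a w.1 ^ 2 * z.1)
        • (u.1 • v - v.1 • u) := by
  rw [quadricForm_apply, hB] at hu hv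
  rw [warpedForm_apply, hB] at hzu hzv
  have huz : B u.2 z.2 = -(ε * z.1 * u.1) / a w.1 ^ 2 := by field_simp; linarith
  have hvz : B v.2 z.2 = -(ε * z.1 * v.1) / a w.1 ^ 2 := by field_simp; linarith
  rw [connectionCurvature, fderiv_warpedChristoffel ha ha' h0, fderiv_warpedChristoffel ha ha' h0]
  simp only [warpedChristoffel_apply, map_add, map_smul, smul_eq_mul, huz, hvz, hu, hv,
    hB v.2 u.2]
  refine Prod.ext ?_ ?_
  · simp only [neg_mul, mul_neg, smul_add, Prod.mk_sub_mk, sub_neg_eq_add, mul_zero, zero_add,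
      neg_smul, smul_neg, Prod.mk_add_mk, Prod.smul_fst, Prod.fst_sub, smul_eq_mul]
    field_simp
    ring
  · simp only [neg_mul, mul_neg, smul_add, Prod.mk_sub_mk, sub_neg_eq_add, mul_zero, zero_add,
      neg_smul, smul_neg, Prod.mk_add_mk, Prod.smul_snd, Prod.snd_sub]
    match_scalars
    all_goals field_simp
    all_goals ring

end WarpedForms

section WarpedModel

theorem exists_eq_of_injective_of_form_eq_zero {𝕜 F W : Type*} [Field 𝕜] [AddCommGroup F]
    [Module 𝕜 F] [AddCommGroup W] [Module 𝕜 W] [FiniteDimensional 𝕜 W]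
    (hfr : Module.finrank 𝕜 W = Module.finrank 𝕜 F + 1) {L : F →ₗ[𝕜] W}
    (hL : ∀ u, L u = 0 → u = 0) {θ : W →ₗ[𝕜] 𝕜} (hθ : θ ≠ 0) (hLθ : ∀ u, θ (L u) = 0)
    {z : W} (hz : θ z = 0) : ∃ u, L u = z := by
  have hle : LinearMap.range L ≤ LinearMap.ker θ := LinearMap.range_le_iff_comap.2 <| by
    ext u
    simp [hLθ u]
  have hrange := LinearMap.finrank_range_of_inj ((injective_iff_map_eq_zero L).2 hL)
  have hker := Module.Dual.finrank_ker_add_one_of_ne_zero (f := θ) hθ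
  have hmem : z ∈ LinearMap.range L := by
    rw [Submodule.eq_of_le_of_finrank_eq hle (by omega)]
    exact hz
  exact hmem

variable {F : Type*} [NormedAddCommGroup F] [NormedSpace ℝ F]
  {K : Type*} [TopologicalSpace K] {J : ModelWithCorners ℝ F K}
  {P : Type*} [TopologicalSpace P] [ChartedSpace K P]
  {V : Type*} [NormedAddCommGroup V] [NormedSpace ℝ V]
  {g : Π p : P, TangentSpace J p →L[ℝ] TangentSpace J p →L[ℝ] ℝ} {Φ : P → ℝ × V}
  {B : V →L[ℝ] V →L[ℝ] ℝ} {ε c : ℝ} {a : ℝ → ℝ}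

theorem quadricForm_mvfderiv_eq_zero (hB : ∀ v v', B v v' = B v' v)
    (hΦc : ∀ p, B (Φ p).2 (Φ p).2 = c) {p : P} (hΦ : MDifferentiableAt J 𝓘(ℝ, ℝ × V) Φ p)
    (u : TangentSpace J p) : quadricForm B (Φ p) (mvfderiv J Φ p u) = 0 := by
  have hq : HasFDerivAt (fun w : ℝ × V ↦ B w.2 w.2)
      ((B.precompR (ℝ × V) (Φ p).2 (.snd ℝ ℝ V)) + B.precompL (ℝ × V) (.snd ℝ ℝ V) (Φ p).2)
      (Φ p) := B.hasFDerivAt_of_bilinear hasFDerivAt_snd hasFDerivAt_snd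
  have hconst : mvfderiv J (fun p' ↦ B (Φ p').2 (Φ p').2) p u = 0 := by
    rw [funext hΦc, mvfderiv_const, zero_apply]
  rw [mvfderiv_comp_vector (Ψ := fun w : ℝ × V ↦ B w.2 w.2) hq.differentiableAt hΦ, hq.fderiv]
    at hconst
  have hsum : B (Φ p).2 (mvfderiv J Φ p u).2 + B (mvfderiv J Φ p u).2 (Φ p).2 = 0 := hconst
  rw [hB _ (Φ p).2] at hsum
  exact add_self_eq_zero.1 hsum

theorem exists_mvfderiv_eq_of_quadricForm_eq_zero [FiniteDimensional ℝ V]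
    (hfr : Module.finrank ℝ V = Module.finrank ℝ F) {p : P} (hp : B (Φ p).2 (Φ p).2 ≠ 0)
    (hinj : ∀ u, mvfderiv J Φ p u = 0 → u = 0)
    (htan : ∀ u, quadricForm B (Φ p) (mvfderiv J Φ p u) = 0)
    {z : ℝ × V} (hz : quadricForm B (Φ p) z = 0) : ∃ u, mvfderiv J Φ p u = z := by
  refine exists_eq_of_injective_of_form_eq_zero (𝕜 := ℝ) (F := F) (W := ℝ × V)
    (L := ContinuousLinearMap.toLinearMap (M := F) (mvfderiv J Φ p))
    (θ := (quadricForm B (Φ p) : ℝ × V →ₗ[ℝ] ℝ)) ?_ hinj ?_ htan hz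
  · rw [Module.finrank_prod, Module.finrank_self, hfr, add_comm]
    rfl
  · exact fun hθ ↦ hp (LinearMap.congr_fun hθ (0, (Φ p).2))

theorem isAmbientModel_warped [FiniteDimensional ℝ V] (hε : ε * ε = 1) (hc : c * c = 1)
    (hB : ∀ v v', B v v' = B v' v) (hB' : ∀ v, (∀ v', B v v' = 0) → v = 0)
    (ha : ∀ p, ContDiffAt ℝ 2 a (Φ p).1) (ha0 : ∀ p, a (Φ p).1 ≠ 0)
    (hΦ : ContMDiff J 𝓘(ℝ, ℝ × V) ∞ Φ) (hΦc : ∀ p, B (Φ p).2 (Φ p).2 = c)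
    (hinj : ∀ (p : P) (u : TangentSpace J p), mvfderiv J Φ p u = 0 → u = 0)
    (hfr : Module.finrank ℝ V = Module.finrank ℝ F)
    (hg : ∀ (p : P) (u v : TangentSpace J p),
      g p u v = warpedForm ε a B (Φ p) (mvfderiv J Φ p u) (mvfderiv J Φ p v)) :
    IsAmbientModel J g Φ (warpedForm ε a B) (quadricForm B) (warpedChristoffel ε c a B) := by
  have hda (p) : DifferentiableAt ℝ a (Φ p).1 := (ha p).differentiableAt two_ne_zero
  have hdda (p) : DifferentiableAt ℝ (deriv a) (Φ p).1 :=
    ((ha p).derivWithin (m := 1) le_rfl).differentiableAt one_ne_zero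
  have htan (p : P) (u : TangentSpace J p) : quadricForm B (Φ p) (mvfderiv J Φ p u) = 0 :=
    quadricForm_mvfderiv_eq_zero hB hΦc ((hΦ p).mdifferentiableAt (by simp)) u
  have hsurj (p : P) (z : ℝ × V) (hz : quadricForm B (Φ p) z = 0) :
      ∃ u, mvfderiv J Φ p u = z :=
    exists_mvfderiv_eq_of_quadricForm_eq_zero hfr
      (by rw [hΦc]; exact left_ne_zero_of_mul_eq_one hc) (hinj p) (htan p) hz
  have hnondeg (p : P) (u : TangentSpace J p) (hu : ∀ v, g p u v = 0) : u = 0 :=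
    hinj p u <| eq_zero_of_forall_warpedForm_eq_zero (left_ne_zero_of_mul_eq_one hε) hc (ha0 p)
      hB hB' (hΦc p) (htan p u) fun z hz ↦ by
        obtain ⟨v, rfl⟩ := hsurj p z hz
        rw [← hg, hu]
  exact
    { contMDiff := hΦ
      metric_eq := hg
      nondegenerate := hnondeg
      form_tangent := htan
      exists_tangent := hsurj
      differentiableAt_metric := fun p ↦
        (hasFDerivAt_warpedForm (hda p).hasDerivAt).differentiableAt
      differentiableAt_form := fun p ↦ hasFDerivAt_quadricForm.differentiableAt
      differentiableAt_connection := fun p ↦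
        (hasFDerivAt_warpedChristoffel (hda p) (hdda p).hasDerivAt (ha0 p)).differentiableAt
      metric_symm := fun w z z' ↦ by
        rw [warpedForm_apply, warpedForm_apply, hB z.2, mul_comm z.1]
      connection_symm := fun w z z' ↦ by
        rw [warpedChristoffel_apply, warpedChristoffel_apply, hB z.2, add_comm (z.1 • _)]
      metric_compatible := fun p _ _ _ _ ↦
        warpedChristoffel_metric_compatible hε (hda p) (ha0 p) hB
      tangent_compatible := fun p _ _ ↦ warpedChristoffel_tangent_compatible hc (hΦc p) }

theorem IsAmbientModel.curvatureTensor_mem_span_pair [IsManifold J ∞ P] [J.Boundaryless]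
    [FiniteDimensional ℝ F] [FiniteDimensional ℝ V]
    (h : IsAmbientModel J g Φ (warpedForm ε a B) (quadricForm B) (warpedChristoffel ε c a B))
    (hB : ∀ v v', B v v' = B v' v) {p : P} (ha : ContDiffAt ℝ 2 a (Φ p).1)
    (ha0 : a (Φ p).1 ≠ 0) {u v w : TangentSpace J p} (hwu : g p w u = 0) (hwv : g p w v = 0) :
    curvatureTensor J g p u v w ∈ Submodule.span ℝ {u, v} := by
  rw [h.metric_eq] at hwu hwv
  have hda : DifferentiableAt ℝ (deriv a) (Φ p).1 :=
    (ha.derivWithin (m := 1) le_rfl).differentiableAt one_ne_zero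
  have hcurv := (h.mvfderiv_curvatureTensor p u v w).trans
    (connectionCurvature_warpedChristoffel hB (ha.differentiableAt two_ne_zero)
      hda.hasDerivAt ha0 (h.form_tangent p u)
      (h.form_tangent p v) hwu hwv)
  have hcomb : curvatureTensor J g p u v w = _ • ((mvfderiv J Φ p u).1 • v
      - (mvfderiv J Φ p v).1 • u) := h.eq_of_mvfderiv_eq (hcurv.trans (by
    rw [map_smul, map_sub, map_smul, map_smul]))
  rw [hcomb]
  exact Submodule.smul_mem _ _ (Submodule.sub_mem _
    (Submodule.smul_mem _ _ (Submodule.subset_span (Or.inr rfl)))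
    (Submodule.smul_mem _ _ (Submodule.subset_span (Or.inl rfl))))

end WarpedModel

section SpaceFormModel

variable {N l : ℕ} {c : ℤˣ}

theorem pseudoEuclideanForm_symm (ν : ℕ) (v v' : EuclideanSpace ℝ (Fin (N + 1))) :
    pseudoEuclideanForm N ν v v' = pseudoEuclideanForm N ν v' v := by
  simp only [Hyperquadric.form_apply, mul_comm (v _)]

theorem eq_zero_of_forall_pseudoEuclideanForm_eq_zero {ν : ℕ} {v : EuclideanSpace ℝ (Fin (N + 1))}
    (hv : ∀ v', pseudoEuclideanForm N ν v v' = 0) : v = 0 := by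
  ext i
  have hi := hv (EuclideanSpace.single i 1)
  rw [Hyperquadric.form_apply, Finset.sum_eq_single i (by simp +contextual) (by simp)] at hi
  have hsign : pseudoSign N ν i ≠ 0 := left_ne_zero_of_mul_eq_one (Hyperquadric.sign_mul_self N ν i)
  simpa [hsign] using hi

theorem Hyperquadric.contMDiff_point :
    ContMDiff (𝓡 N) 𝓘(ℝ, EuclideanSpace ℝ (Fin (N + 1))) ∞ (point : Hyperquadric N l c → _) := by
  intro p
  refine contMDiffAt_iff.2 ⟨isInducing_point.continuous.continuousAt, ?_⟩
  set i := (exists_coord_ne_zero p).choose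
  set σ : ℝ := ((SignType.sign (p.point i) : SignType) : ℝ)
  have hp : 0 < σ * p.point i := mem_chart_source (EuclideanSpace ℝ (Fin N)) p
  have hσ : σ * σ = 1 := by
    rcases lt_or_gt_of_ne (right_ne_zero_of_mul hp.ne') with hi | hi <;> simp [σ, hi]
  have hnhds : {y | 0 < sqCoord l c i y} ∈ 𝓝 (dropCoord i p.point) :=
    (isOpen_lt continuous_const (contDiff_sqCoord i).continuous).mem_nhds (sqCoord_pos i hp)
  refine (((contDiffOn_graphPoint i σ).contDiffAt hnhds).congr_of_eventuallyEq
    ?_).contDiffWithinAt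
  filter_upwards [hnhds] with y hy
  exact ofGraph_point p i σ hσ hy

/-- The inclusion of `I × 𝕄^N_l(c)` in `ℝ × 𝔼^{N+1}`. -/
def warpedInclusion (I : TopologicalSpace.Opens ℝ) (p₀ : Hyperquadric N l c)
    (q : I × spaceForm p₀) : ℝ × EuclideanSpace ℝ (Fin (N + 1)) :=
  (q.1, q.2.1.point)

variable {I : TopologicalSpace.Opens ℝ} {p₀ : Hyperquadric N l c}

theorem contMDiff_interval : ContMDiff (𝓘(ℝ, ℝ).prod (𝓡 N)) 𝓘(ℝ, ℝ) ∞
    (fun q : I × spaceForm p₀ ↦ (q.1 : ℝ)) :=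
  contMDiff_subtype_val.comp contMDiff_fst

theorem contMDiff_spaceForm_point :
    ContMDiff (𝓘(ℝ, ℝ).prod (𝓡 N)) 𝓘(ℝ, EuclideanSpace ℝ (Fin (N + 1))) ∞
      (fun q : I × spaceForm p₀ ↦ q.2.1.point) :=
  Hyperquadric.contMDiff_point.comp (contMDiff_subtype_val.comp contMDiff_snd)

theorem contMDiff_warpedInclusion : ContMDiff (𝓘(ℝ, ℝ).prod (𝓡 N))
    𝓘(ℝ, ℝ × EuclideanSpace ℝ (Fin (N + 1))) ∞ (warpedInclusion I p₀) :=
  contMDiff_interval.prodMk_space contMDiff_spaceForm_point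

theorem mvfderiv_warpedInclusion (p : I × spaceForm p₀)
    (u : TangentSpace (𝓘(ℝ, ℝ).prod (𝓡 N)) p) :
    mvfderiv (𝓘(ℝ, ℝ).prod (𝓡 N)) (warpedInclusion I p₀) p u
      = (mvfderiv (𝓘(ℝ, ℝ).prod (𝓡 N)) (fun q : I × spaceForm p₀ ↦ (q.1 : ℝ)) p u,
        mvfderiv (𝓘(ℝ, ℝ).prod (𝓡 N)) (fun q : I × spaceForm p₀ ↦ q.2.1.point) p u) :=
  mvfderiv_prodMk ((contMDiff_interval p).mdifferentiableAt (by simp))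
    ((contMDiff_spaceForm_point p).mdifferentiableAt (by simp)) u

theorem mvfderiv_warpedInclusion_injective {p : I × spaceForm p₀}
    {u : TangentSpace (𝓘(ℝ, ℝ).prod (𝓡 N)) p}
    (hu : mvfderiv (𝓘(ℝ, ℝ).prod (𝓡 N)) (warpedInclusion I p₀) p u = 0) : u = 0 := by
  rw [mvfderiv_eq_fderiv_inChart_self ((contMDiff_warpedInclusion p).of_le ENat.LEInfty.out)] at hu
  set i := (Hyperquadric.exists_coord_ne_zero p.2.1).choose
  -- The charts of the space form drop a coordinate, so `ρ` inverts the inclusion read in them.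
  let ρ : ℝ × EuclideanSpace ℝ (Fin (N + 1)) → ℝ × EuclideanSpace ℝ (Fin N) :=
    fun w ↦ (w.1, Hyperquadric.dropCoord i w.2)
  have hρ : ContDiff ℝ ∞ ρ :=
    contDiff_fst.prodMk ((Hyperquadric.contDiff_dropCoord i).comp contDiff_snd)
  have hρ_chart (q) : ρ (warpedInclusion I p₀ q) = extChartAt (𝓘(ℝ, ℝ).prod (𝓡 N)) p q := rfl
  set y := extChartAt (𝓘(ℝ, ℝ).prod (𝓡 N)) p p
  have hleft : ρ ∘ inChart (𝓘(ℝ, ℝ).prod (𝓡 N)) (warpedInclusion I p₀) p =ᶠ[𝓝 y] id := by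
    filter_upwards [extChartAt_target_mem_nhds (I := 𝓘(ℝ, ℝ).prod (𝓡 N)) p] with y' hy'
    exact (hρ_chart _).trans ((extChartAt (𝓘(ℝ, ℝ).prod (𝓡 N)) p).right_inv hy')
  have hinChart : DifferentiableAt ℝ
      (inChart (𝓘(ℝ, ℝ).prod (𝓡 N)) (warpedInclusion I p₀) p) y :=
    (contDiffAt_inChart (n := 1) p (mem_chart_source _ p)
      ((contMDiff_warpedInclusion p).of_le ENat.LEInfty.out)).differentiableAt one_ne_zero
  have hcomp := fderiv_comp y (hρ.differentiable (by simp) _) hinChart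
  rw [hleft.fderiv_eq, fderiv_id] at hcomp
  have hu_eq : u = fderiv ℝ ρ _ _ := DFunLike.congr_fun hcomp u
  rw [hu_eq]
  exact (congrArg _ hu).trans (map_zero _)

theorem isAmbientModel_warpedMetric (ε : ℤˣ) {a : ℝ → ℝ} (ha : ContDiffOn ℝ 2 a I)
    (ha0 : ∀ t ∈ I, a t ≠ 0) :
    IsAmbientModel (𝓘(ℝ, ℝ).prod (𝓡 N)) (warpedMetric ε I a p₀) (warpedInclusion I p₀)
      (warpedForm ((ε : ℤ) : ℝ) a (pseudoEuclideanForm N (ambientIndex l c)))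
      (quadricForm (pseudoEuclideanForm N (ambientIndex l c)))
      (warpedChristoffel ((ε : ℤ) : ℝ) ((c : ℤ) : ℝ) a
        (pseudoEuclideanForm N (ambientIndex l c))) := by
  refine isAmbientModel_warped (mod_cast Int.units_coe_mul_self ε)
    (mod_cast Int.units_coe_mul_self c) (pseudoEuclideanForm_symm _)
    (fun _ ↦ eq_zero_of_forall_pseudoEuclideanForm_eq_zero)
    (fun p ↦ ha.contDiffAt (I.isOpen.mem_nhds p.1.2)) (fun p ↦ ha0 p.1 p.1.2)
    contMDiff_warpedInclusion (fun p ↦ p.2.1.form_eq)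
    (fun _ _ ↦ mvfderiv_warpedInclusion_injective) ?_ fun p u v ↦ ?_
  · simp [Module.finrank_prod, add_comm]
  · rw [warpedForm_apply, mvfderiv_warpedInclusion, mvfderiv_warpedInclusion]
    rfl

end SpaceFormModel

section RicciEquation

theorem normalPart_curvatureTensor_warpedMetric {E : Type*} [NormedAddCommGroup E]
    [NormedSpace ℝ E] [FiniteDimensional ℝ E] {H : Type*} [TopologicalSpace H]
    {𝓜 : ModelWithCorners ℝ E H} {M : Type*} [TopologicalSpace M] [ChartedSpace H M]
    [IsManifold 𝓜 ∞ M] {gM : Π x : M, TangentSpace 𝓜 x →L[ℝ] TangentSpace 𝓜 x →L[ℝ] ℝ}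
    (hgM : IsSemiRiemannianMetric 𝓜 gM) {N l : ℕ} {c ε : ℤˣ} {p₀ : Hyperquadric N l c}
    {I : TopologicalSpace.Opens ℝ} {a : ℝ → ℝ} (ha : ContDiffOn ℝ 2 a I)
    (ha0 : ∀ t ∈ I, a t ≠ 0) {f : M → I × spaceForm p₀}
    (hf : IsIsometricImmersion 𝓜 (𝓘(ℝ, ℝ).prod (𝓡 N)) gM (warpedMetric ε I a p₀) f) {x : M}
    {η : TangentSpace (𝓘(ℝ, ℝ).prod (𝓡 N)) (f x)}
    (hη : IsNormalTo 𝓜 (𝓘(ℝ, ℝ).prod (𝓡 N)) (warpedMetric ε I a p₀) f x η)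
    (u v : TangentSpace 𝓜 x) :
    normalPart 𝓜 (𝓘(ℝ, ℝ).prod (𝓡 N)) gM (warpedMetric ε I a p₀) f x
      (curvatureTensor (𝓘(ℝ, ℝ).prod (𝓡 N)) (warpedMetric ε I a p₀) (f x)
        (mfderiv 𝓜 (𝓘(ℝ, ℝ).prod (𝓡 N)) f x u) (mfderiv 𝓜 (𝓘(ℝ, ℝ).prod (𝓡 N)) f x v) η)
      = 0 := by
  obtain ⟨κ, τ, hspan⟩ := Submodule.mem_span_pair.1 <|
    (isAmbientModel_warpedMetric ε ha ha0).curvatureTensor_mem_span_pair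
      (pseudoEuclideanForm_symm _) (ha.contDiffAt (I.isOpen.mem_nhds (f x).1.2))
      (ha0 _ (f x).1.2) (hη u) (hη v)
  rw [← hspan, ← map_smul, ← map_smul, ← map_add]
  exact normalPart_mfderiv hgM hf _

theorem proposition3p4_general {E : Type*} [NormedAddCommGroup E] [NormedSpace ℝ E]
    [FiniteDimensional ℝ E] {H : Type*} [TopologicalSpace H] {𝓜 : ModelWithCorners ℝ E H}
    [𝓜.Boundaryless] {M : Type*} [TopologicalSpace M] [ChartedSpace H M] [IsManifold 𝓜 ∞ M]
    {gM : Π x : M, TangentSpace 𝓜 x →L[ℝ] TangentSpace 𝓜 x →L[ℝ] ℝ}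
    (hgM : IsSemiRiemannianMetric 𝓜 gM) {N l : ℕ} {c ε : ℤˣ} {p₀ : Hyperquadric N l c}
    {I : TopologicalSpace.Opens ℝ} {a : ℝ → ℝ} (ha : ContDiffOn ℝ 2 a I)
    (ha0 : ∀ t ∈ I, a t ≠ 0) {f : M → I × spaceForm p₀}
    (hf : IsIsometricImmersion 𝓜 (𝓘(ℝ, ℝ).prod (𝓡 N)) gM (warpedMetric ε I a p₀) f) {x : M}
    {X Y : Π x : M, TangentSpace 𝓜 x}
    (hX : MDifferentiableAt 𝓜 𝓜.tangent (fun x ↦ (⟨x, X x⟩ : TangentBundle 𝓜 M)) x)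
    (hY : MDifferentiableAt 𝓜 𝓜.tangent (fun x ↦ (⟨x, Y x⟩ : TangentBundle 𝓜 M)) x)
    {η : Π x : M, TangentSpace (𝓘(ℝ, ℝ).prod (𝓡 N)) (f x)}
    (hη : ContMDiffAt 𝓜 (𝓘(ℝ, ℝ).prod (𝓡 N)).tangent 2
      (fun x ↦ (⟨f x, η x⟩ : TangentBundle (𝓘(ℝ, ℝ).prod (𝓡 N)) (I × spaceForm p₀))) x)
    (hη_normal : ∀ᶠ x' in 𝓝 x,
      IsNormalTo 𝓜 (𝓘(ℝ, ℝ).prod (𝓡 N)) (warpedMetric ε I a p₀) f x' (η x')) :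
    normalCurvature 𝓜 (𝓘(ℝ, ℝ).prod (𝓡 N)) gM (warpedMetric ε I a p₀) f X Y η x
        = secondFundamentalForm 𝓜 (𝓘(ℝ, ℝ).prod (𝓡 N)) gM (warpedMetric ε I a p₀) f x
            (shapeOperator 𝓜 (𝓘(ℝ, ℝ).prod (𝓡 N)) gM (warpedMetric ε I a p₀) f x (η x) (Y x))
            (X x)
          - secondFundamentalForm 𝓜 (𝓘(ℝ, ℝ).prod (𝓡 N)) gM (warpedMetric ε I a p₀) f x
            (shapeOperator 𝓜 (𝓘(ℝ, ℝ).prod (𝓡 N)) gM (warpedMetric ε I a p₀) f x (η x) (X x))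
            (Y x)
      ∧ normalPart 𝓜 (𝓘(ℝ, ℝ).prod (𝓡 N)) gM (warpedMetric ε I a p₀) f x
          (curvatureTensor (𝓘(ℝ, ℝ).prod (𝓡 N)) (warpedMetric ε I a p₀) (f x)
            (mfderiv 𝓜 (𝓘(ℝ, ℝ).prod (𝓡 N)) f x (X x))
            (mfderiv 𝓜 (𝓘(ℝ, ℝ).prod (𝓡 N)) f x (Y x)) (η x)) = 0 := by
  have hmodel := isAmbientModel_warpedMetric (p₀ := p₀) ε ha ha0
  have hcurv := normalPart_curvatureTensor_warpedMetric hgM ha ha0 hf hη_normal.self_of_nhds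
    (X x) (Y x)
  have hη_ambient := contMDiffAt_ambientField (n := 2) (f := f) hmodel.contMDiffAt hη
  exact ⟨by rw [hmodel.ricci_equation hgM hf hη_ambient hη_normal hX hY, hcurv, zero_add], hcurv⟩

end RicciEquation

end

/-- `I ×_a 𝕄^N_λ(c)` carries `⟨ , ⟩ = ε dt² + a² g`, and `f : M → εI ×_a 𝕄^N_λ(c)` is an isometric
immersion of the semi-Riemannian manifold `(M, gM)`. The fields `X`, `Y` and the normal field `η`
are smooth on an open set `U`; `U` is arbitrary, so this covers all tangent vectors `X`, `Y` and
normal vectors `η` at all points. -/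
theorem proposition3p4
    (N l : ℕ) (hN : 2 ≤ N) (hl : l ≤ N) (c ε : ℤˣ) (p₀ : Hyperquadric N l c)
    (I : TopologicalSpace.Opens ℝ) (a : ℝ → ℝ) (ha : ContDiffOn ℝ ∞ a I) (ha_pos : ∀ t ∈ I, 0 < a t)
    (n : ℕ) {M : Type*} [TopologicalSpace M] [ChartedSpace (EuclideanSpace ℝ (Fin n)) M]
    [IsManifold (𝓡 n) ∞ M]
    (gM : Π x : M, TangentSpace (𝓡 n) x →L[ℝ] TangentSpace (𝓡 n) x →L[ℝ] ℝ)
    (hgM : IsSemiRiemannianMetric (𝓡 n) gM)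
    (f : M → I × spaceForm p₀)
    (hf : IsIsometricImmersion (𝓡 n) (𝓘(ℝ, ℝ).prod (𝓡 N)) gM (warpedMetric ε I a p₀) f)
    (U : Set M) (hU : IsOpen U)
    (X Y : Π x : M, TangentSpace (𝓡 n) x)
    (hX : ContMDiffOn (𝓡 n) (𝓡 n).tangent ∞ (fun x ↦ (⟨x, X x⟩ : TangentBundle (𝓡 n) M)) U)
    (hY : ContMDiffOn (𝓡 n) (𝓡 n).tangent ∞ (fun x ↦ (⟨x, Y x⟩ : TangentBundle (𝓡 n) M)) U)
    (η : Π x : M, TangentSpace (𝓘(ℝ, ℝ).prod (𝓡 N)) (f x))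
    (hη : ContMDiffOn (𝓡 n) (𝓘(ℝ, ℝ).prod (𝓡 N)).tangent ∞
      (fun x ↦ (⟨f x, η x⟩ : TangentBundle (𝓘(ℝ, ℝ).prod (𝓡 N)) (I × spaceForm p₀))) U)
    (hη_normal : ∀ x ∈ U,
      IsNormalTo (𝓡 n) (𝓘(ℝ, ℝ).prod (𝓡 N)) (warpedMetric ε I a p₀) f x (η x)) :
    ∀ x ∈ U,
      normalCurvature (𝓡 n) (𝓘(ℝ, ℝ).prod (𝓡 N)) gM (warpedMetric ε I a p₀) f X Y η x
        = secondFundamentalForm (𝓡 n) (𝓘(ℝ, ℝ).prod (𝓡 N)) gM (warpedMetric ε I a p₀) f x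
            (shapeOperator (𝓡 n) (𝓘(ℝ, ℝ).prod (𝓡 N)) gM (warpedMetric ε I a p₀) f x (η x) (Y x))
            (X x)
          - secondFundamentalForm (𝓡 n) (𝓘(ℝ, ℝ).prod (𝓡 N)) gM (warpedMetric ε I a p₀) f x
            (shapeOperator (𝓡 n) (𝓘(ℝ, ℝ).prod (𝓡 N)) gM (warpedMetric ε I a p₀) f x (η x) (X x))
            (Y x)
      ∧ normalPart (𝓡 n) (𝓘(ℝ, ℝ).prod (𝓡 N)) gM (warpedMetric ε I a p₀) f x
          (curvatureTensor (𝓘(ℝ, ℝ).prod (𝓡 N)) (warpedMetric ε I a p₀) (f x)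
            (mfderiv (𝓡 n) (𝓘(ℝ, ℝ).prod (𝓡 N)) f x (X x))
            (mfderiv (𝓡 n) (𝓘(ℝ, ℝ).prod (𝓡 N)) f x (Y x)) (η x)) = 0 := by
  intro x hx
  have hUx := hU.mem_nhds hx
  exact proposition3p4_general hgM (ha.of_le ENat.LEInfty.out) (fun t ht ↦ (ha_pos t ht).ne') hf
    ((hX.contMDiffAt hUx).mdifferentiableAt (by simp))
    ((hY.contMDiffAt hUx).mdifferentiableAt (by simp))
    ((hη.contMDiffAt hUx).of_le ENat.LEInfty.out) (Filter.eventually_of_mem hUx hη_normal)
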